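/- Let $\mathcal H$ be a complex Hilbert space, let $A$ be a closed densely defined symmetric operator in $\mathcal H$ with finite and equal deficiency indices $n_\pm(A)=n$, and let $B$ be a bounded selfadjoint operator on $\mathcal H$ with $0\in\sigma_c(B)$ (that is, $B$ is injective with dense range but is not invertible). Suppose that there are $\lambda\in\mathbb R$ and $C>0$ with $\|(A-\lambda B)x\|\ge C\|x\|$ for all $x\in D(A)$. Let $E$ be the spectral function of $B$, $J=E(0,\infty)-E(-\infty,0)$ and $|B|=JB\ge 0$. Let $\mathcal K$ be the completion of $\mathcal H$ with respect to $x\mapsto\||B|^{1/2}x\|$: the space of sequences $(x_n)$ in $\mathcal H$ for which $|B|^{1/2}x_n$ converges, modulo those with $|B|^{1/2}x_n\to 0$, with $((x_n),(y_n))_{\mathcal K}=\lim(|B|^{1/2}x_n,|B|^{1/2}y_n)$. Set $T:\mathcal K\to\mathcal H$, $T(x_n)=\lim|B|^{1/2}x_n$, and $[(x_n),(y_n)]_{\mathcal K}=\lim (J|B|^{1/2}x_n,|B|^{1/2}y_n)$. Regard $\mathcal H$ as a subspace of $\mathcal K$ (constant sequences). Adjoints and selfadjointness of operators in $\mathcal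 K$ refer to $[\cdot,\cdot]_{\mathcal K}$. For an operator $\widetilde A$ in $\mathcal H$ let $\Phi(\widetilde A)=T^{-1}J|B|^{-1/2}\widetilde A$ be the operator in $\mathcal K$ with domain $D(|B|^{-1/2}\widetilde A)=\{x\in D(\widetilde A):\widetilde Ax\in R(|B|^{1/2})\}$, and put $S=\Phi(A)$. By a closed extension of a symmetric operator $A$ (resp. $S$) we mean a closed operator $\widetilde A$ with $A\subset\widetilde A\subset A^*$ (resp. $S\subset\widetilde S\subset S^*$). Then: 1. $S$ is densely defined, closed and symmetric in the Krein space $\mathcal K$, and $S^*=\Phi(A^*)$. 2. $\Phi$ is a bijection from the set of all closed extensions of $A$ onto the set of all closed extensions of $S$. 3. $\Phi$ is a bijection from the set of all selfadjoint extensions of $A$ in $\mathcal H$ onto the set of all selfadjoint extensions of $S$ in $\mathcal K$. In particular, if $\widetilde A$ is a selfadjoint extension of $A$, then the operator $\widetilde S=\Phi(\widetilde A)$, given by $D(\widetilde S)=D(|B|^{-1/2}\widetilde A)$ and $T\widetilde Sx=J|B|^{-1/2}\widetilde Ax$, is a selfadjoint extension of $S$. 4. Let $\Omega$ be a Hilbert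 space and let $\Gamma_1,\Gamma_2:D(A^*)\to\Omega$ be linear maps, bounded for the graph norm of $A^*$, such that $x\mapsto(\Gamma_1x,\Gamma_2x)$ maps $D(A^*)$ onto $\Omega\times\Omega$ and $(A^*x,y)-(x,A^*y)=(\Gamma_1x,\Gamma_2y)_\Omega-(\Gamma_2x,\Gamma_1y)_\Omega$ for all $x,y\in D(A^*)$ (a space of boundary values for $A^*$). Then the restrictions $\widetilde\Gamma_i=\Gamma_i|_{D(S^*)}$ form a space of boundary values $\{\Omega,I,\widetilde\Gamma_1,\widetilde\Gamma_2\}$ for $S^*$: they are bounded for the graph norm of $S^*$ in $\mathcal K$, $x\mapsto(\widetilde\Gamma_1x,\widetilde\Gamma_2x)$ maps $D(S^*)$ onto $\Omega\times\Omega$, and $[S^*x,y]_{\mathcal K}-[x,S^*y]_{\mathcal K}=(\widetilde\Gamma_1x,\widetilde\Gamma_2y)_\Omega-(\widetilde\Gamma_2x,\widetilde\Gamma_1y)_\Omega$ for all $x,y\in D(S^*)$. Moreover, for every linear relation $\theta\subset\Omega\times\Omega$, $\Phi$ maps the restriction of $A^*$ to $\{x\in D(A^*):(\Gamma_2x,\Gamma_1x)\in\theta\}$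 to the restriction of $S^*$ to $\{x\in D(S^*):(\widetilde\Gamma_2x,\widetilde\Gamma_1x)\in\theta\}$. -/

import Mathlib

open Filter Topology
open scoped ComplexConjugate LinearPMap

noncomputable section

namespace PencilReduction

/-! ### Pencils `A - λB`, deficiency indices, continuous spectrum -/

section Pencil

variable {H : Type*} [NormedAddCommGroup H] [InnerProductSpace ℂ H]

/-- The operator `A - λB` on the domain of `A`. -/
def pencil (A : H →ₗ.[ℂ] H) (B : H →L[ℂ] H) (l : ℂ) : A.domain →ₗ[ℂ] H :=
  A.toFun - l • ((B : H →ₗ[ℂ] H) ∘ₗ A.domain.subtype)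

/-- The points of regular type of the pencil `A - λB`. -/
def regularPoints (A : H →ₗ.[ℂ] H) (B : H →L[ℂ] H) : Set ℂ :=
  {l | ∃ C : ℝ, 0 < C ∧ ∀ x : A.domain, C * ‖(x : H)‖ ≤ ‖pencil A B l x‖}

/-- The codimension of the range of `A - μ`. -/
def defect (A : H →ₗ.[ℂ] H) (μ : ℂ) : Cardinal :=
  Module.rank ℂ (H ⧸ LinearMap.range (pencil A 1 μ))

/-- The deficiency indices of `A` are `n₊ = p` and `n₋ = m`. For a closed symmetric operator the
two codimensions do not depend on the choice of `μ` in the upper half-plane. -/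
def HasDeficiencyIndices (A : H →ₗ.[ℂ] H) (p m : ℕ) : Prop :=
  ∃ μ : ℂ, 0 < μ.im ∧ defect A μ = p ∧ defect A (conj μ) = m

/-- The continuous spectrum of a bounded operator: `B - l` is not invertible, but it is injective
and has dense range. -/
def continuousSpectrum (B : H →L[ℂ] H) : Set ℂ :=
  {l | l ∈ spectrum ℂ B ∧ Function.Injective (B - l • (1 : H →L[ℂ] H)) ∧
    DenseRange (B - l • (1 : H →L[ℂ] H))}

end Pencil

/-! ### Spectral data of the bounded selfadjoint operator `B` -/

section Spectral

variable {H : Type*} [NormedAddCommGroup H] [InnerProductSpace ℂ H] [CompleteSpace H]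

/-- The spectral subspace of `B` for an open set `U ⊆ ℝ`: the closed linear span of the ranges of
the operators `f(B)`, where `f` is continuous on `ℝ` and vanishes off `U`. -/
def spectralSubspace (B : H →L[ℂ] H) (U : Set ℝ) : Submodule ℂ H :=
  (⨆ f : {f : ℝ → ℝ // Continuous f ∧ ∀ t, t ∉ U → f t = 0},
    LinearMap.range (cfc f.1 B : H →L[ℂ] H).toLinearMap).topologicalClosure

instance (B : H →L[ℂ] H) (U : Set ℝ) : CompleteSpace (spectralSubspace B U) :=
  (Submodule.isClosed_topologicalClosure _).completeSpace_coe

/-- The spectral projection `E(U)` of `B`, for `U ⊆ ℝ` open. -/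
def spectralProj (B : H →L[ℂ] H) (U : Set ℝ) : H →L[ℂ] H :=
  (spectralSubspace B U).starProjection

/-- `J = E(0,∞) - E(-∞,0)`. -/
def sgn (B : H →L[ℂ] H) : H →L[ℂ] H :=
  spectralProj B (Set.Ioi 0) - spectralProj B (Set.Iio 0)

/-- `|B|^{1/2}`, by the functional calculus. -/
def rootAbs (B : H →L[ℂ] H) : H →L[ℂ] H :=
  cfc (fun t : ℝ => √|t|) B

/-! ### The completion `K` of `H` with respect to `‖|B|^{1/2} x‖` -/

/-- Sequences `x` in `H` for which `|B|^{1/2} x_n` converges. -/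
def preK (B : H →L[ℂ] H) : Submodule ℂ (ℕ → H) where
  carrier := {x | ∃ l, Tendsto (fun n => rootAbs B (x n)) atTop (𝓝 l)}
  add_mem' := by
    rintro x y ⟨l, hl⟩ ⟨m, hm⟩
    exact ⟨l + m, by simpa using hl.add hm⟩
  zero_mem' := ⟨0, by simp⟩
  smul_mem' := by
    rintro c x ⟨l, hl⟩
    exact ⟨c • l, by simpa using hl.const_smul c⟩

/-- The map `(x_n) ↦ lim |B|^{1/2} x_n`. -/
def preT (B : H →L[ℂ] H) : preK B →ₗ[ℂ] H where
  toFun x := x.2.choose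
  map_add' x y := by
    refine tendsto_nhds_unique (x + y).2.choose_spec ?_
    simpa using x.2.choose_spec.add y.2.choose_spec
  map_smul' c x := by
    refine tendsto_nhds_unique (c • x).2.choose_spec ?_
    simpa using x.2.choose_spec.const_smul c

lemma tendsto_preT (B : H →L[ℂ] H) (x : preK B) :
    Tendsto (fun n => rootAbs B (x.1 n)) atTop (𝓝 (preT B x)) :=
  x.2.choose_spec

/-- The sequences equivalent to zero: those with `|B|^{1/2} x_n → 0`. -/
def nullK (B : H →L[ℂ] H) : Submodule ℂ (preK B) where
  carrier := {x | Tendsto (fun n => rootAbs B (x.1 n)) atTop (𝓝 0)}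
  add_mem' := by
    intro x y hx hy
    simpa using Tendsto.add hx hy
  zero_mem' := by simp
  smul_mem' := by
    intro c x hx
    simpa using Tendsto.const_smul hx c

lemma nullK_eq_ker (B : H →L[ℂ] H) : nullK B = LinearMap.ker (preT B) := by
  ext x
  refine ⟨fun h => tendsto_nhds_unique (tendsto_preT B x) h, fun h => ?_⟩
  have := tendsto_preT B x
  rwa [LinearMap.mem_ker.1 h] at this

/-- The space `K`. -/
def K (B : H →L[ℂ] H) : Type _ := preK B ⧸ nullK B

instance (B : H →L[ℂ] H) : AddCommGroup (K B) :=
  inferInstanceAs (AddCommGroup (preK B ⧸ nullK B))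

instance (B : H →L[ℂ] H) : Module ℂ (K B) :=
  inferInstanceAs (Module ℂ (preK B ⧸ nullK B))

/-- The map `T : K → H`, `T (x_n) = lim |B|^{1/2} x_n`. -/
def T (B : H →L[ℂ] H) : K B →ₗ[ℂ] H :=
  (nullK B).liftQ (preT B) (nullK_eq_ker B).le

lemma T_injective (B : H →L[ℂ] H) : Function.Injective (T B) :=
  LinearMap.ker_eq_bot.1 (Submodule.ker_liftQ_eq_bot _ _ _ (nullK_eq_ker B).ge)

/-- The element of `K` given by the constant sequence `x`. -/
def toK (B : H →L[ℂ] H) : H →ₗ[ℂ] K B :=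
  (nullK B).mkQ ∘ₗ LinearMap.codRestrict (preK B) (LinearMap.pi fun _ => LinearMap.id)
    (fun _ => ⟨_, tendsto_const_nhds⟩)

lemma T_toK (B : H →L[ℂ] H) (x : H) : T B (toK B x) = rootAbs B x :=
  tendsto_nhds_unique (tendsto_preT B _) tendsto_const_nhds

/-- The positive definite inner product of `K`: as the inner product of `H` is continuous,
`lim (|B|^{1/2} x_n, |B|^{1/2} y_n) = (T x, T y)`. -/
instance (B : H →L[ℂ] H) : NormedAddCommGroup (K B) :=
  NormedAddCommGroup.induced (K B) H (T B) (T_injective B)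

instance (B : H →L[ℂ] H) : InnerProductSpace ℂ (K B) where
  inner x y := inner ℂ (T B x) (T B y)
  norm_smul_le c x := by
    change ‖T B (c • x)‖ ≤ ‖c‖ * ‖T B x‖
    rw [map_smul, norm_smul]
  norm_sq_eq_re_inner x := by
    change ‖T B x‖ ^ 2 = _
    exact norm_sq_eq_re_inner (𝕜 := ℂ) (T B x)
  conj_inner_symm x y := inner_conj_symm _ _
  add_left x y z := by simp
  smul_left x y r := by simp [mul_comm]

/-- `K` is a Hilbert space: `T` maps it isometrically onto the closure of the range of
`|B|^{1/2}`. -/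
instance (B : H →L[ℂ] H) : CompleteSpace (K B) := by
  have hi : Isometry (T B) := AddMonoidHomClass.isometry_of_norm (T B) (fun x => rfl)
  have hr : (Set.range (T B)) = closure (Set.range (rootAbs B)) := by
    ext y
    rw [mem_closure_iff_seq_limit]
    constructor
    · rintro ⟨k, rfl⟩
      obtain ⟨x, rfl⟩ := Submodule.mkQ_surjective (nullK B) k
      exact ⟨fun n => rootAbs B (x.1 n), fun n => ⟨_, rfl⟩, tendsto_preT B x⟩
    · rintro ⟨u, hu, hl⟩
      choose x hx using hu
      have hm : x ∈ preK B := ⟨y, by simpa [hx] using hl⟩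
      refine ⟨(nullK B).mkQ ⟨x, hm⟩, ?_⟩
      refine tendsto_nhds_unique (tendsto_preT B ⟨x, hm⟩) (by simpa [hx] using hl)
  refine (completeSpace_iff_isComplete_range hi.isUniformInducing).2 ?_
  rw [hr]; exact isClosed_closure.isComplete

/-- The indefinite inner product of `K`,
`[x, y] = lim (J |B|^{1/2} x_n, |B|^{1/2} y_n) = (J T x, T y)`. -/
def kreinForm (B : H →L[ℂ] H) (x y : K B) : ℂ :=
  inner ℂ (sgn B (T B x)) (T B y)

/-! ### Operators in the Krein space `K` -/

/-- The pairs `(y, z)` with `[S x, y] = [x, z]` for all `x ∈ D(S)`. -/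
def kreinAdjointGraph (B : H →L[ℂ] H) (S : K B →ₗ.[ℂ] K B) : Submodule ℂ (K B × K B) where
  carrier := {p | ∀ x : S.domain, kreinForm B (S x) p.1 = kreinForm B x p.2}
  add_mem' := by
    intro p q hp hq x
    have h1 := hp x
    have h2 := hq x
    simp only [kreinForm, Prod.fst_add, Prod.snd_add, map_add, inner_add_right] at *
    rw [h1, h2]
  zero_mem' := by intro x; simp [kreinForm]
  smul_mem' := by
    intro c p hp x
    have h1 := hp x
    simp only [kreinForm, Prod.smul_fst, Prod.smul_snd, map_smul, inner_smul_right] at *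
    rw [h1]

/-- The adjoint of a densely defined operator in the Krein space `K`. -/
def kreinAdjoint (B : H →L[ℂ] H) (S : K B →ₗ.[ℂ] K B) : K B →ₗ.[ℂ] K B :=
  (kreinAdjointGraph B S).toLinearPMap

/-- Selfadjoint operators in the Krein space `K`. -/
def IsKreinSelfAdjoint (B : H →L[ℂ] H) (S : K B →ₗ.[ℂ] K B) : Prop :=
  Dense (S.domain : Set (K B)) ∧ kreinAdjoint B S = S

/-! ### The reduction operator -/

/-- The pairs `(x, k) ∈ K × K` with `x ∈ D(A)`, `A x ∈ R(|B|^{1/2})` and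
`T k = J |B|^{-1/2} A x`. -/
def reductionGraph (B : H →L[ℂ] H) (A : H →ₗ.[ℂ] H) : Submodule ℂ (K B × K B) where
  carrier := {p | ∃ (x : A.domain) (w : H),
    rootAbs B w = A x ∧ p.1 = toK B x ∧ T B p.2 = sgn B w}
  add_mem' := by
    rintro p q ⟨x, w, h1, h2, h3⟩ ⟨y, v, g1, g2, g3⟩
    exact ⟨x + y, w + v, by simp [h1, g1, LinearPMap.map_add], by simp [h2, g2], by simp [h3, g3]⟩
  zero_mem' := ⟨0, 0, by simp, by simp, by simp⟩
  smul_mem' := by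
    rintro c p ⟨x, w, h1, h2, h3⟩
    exact ⟨c • x, c • w, by simp [h1, LinearPMap.map_smul], by simp [h2], by simp [h3]⟩

/-- The operator `T⁻¹ J |B|^{-1/2} A` in `K`, with domain `D(|B|^{-1/2} A) ⊆ H ⊆ K`
(for injective `B`; see `reduction_graph`). -/
def reduction (B : H →L[ℂ] H) (A : H →ₗ.[ℂ] H) : K B →ₗ.[ℂ] K B :=
  (reductionGraph B A).toLinearPMap

/-- If `B` is injective, then so is `|B|^{1/2}`. -/
lemma rootAbs_injective (B : H →L[ℂ] H) (hB : IsSelfAdjoint B) (h0 : Function.Injective B) :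
    Function.Injective (rootAbs B) := by
  have key : B = cfc (fun t : ℝ => Real.sign t * √|t|) B * rootAbs B := by
    have hc : Continuous fun t : ℝ => Real.sign t * √|t| := by
      have : (fun t : ℝ => Real.sign t * √|t|) = fun t => √(max t 0) - √(max (-t) 0) := by
        funext t
        rcases lt_trichotomy t 0 with h | h | h
        · rw [Real.sign_of_neg h, abs_of_neg h, max_eq_right h.le, max_eq_left (by linarith)]
          simp
        · simp [h]
        · rw [Real.sign_of_pos h, abs_of_pos h, max_eq_left h.le, max_eq_right (by linarith)]
          simp
      rw [this]
      fun_prop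
    have hd : Continuous fun t : ℝ => √|t| := by fun_prop
    rw [rootAbs, ← cfc_mul _ _ B hc.continuousOn hd.continuousOn]
    conv_lhs => rw [← cfc_id ℝ B]
    refine cfc_congr fun t _ => ?_
    change t = _
    rw [mul_assoc, Real.mul_self_sqrt (abs_nonneg t)]
    rcases lt_trichotomy t 0 with h | h | h
    · rw [Real.sign_of_neg h, abs_of_neg h]; ring
    · simp [h]
    · rw [Real.sign_of_pos h, abs_of_pos h]; ring
  intro x y hxy
  apply h0
  rw [key, mul_apply_eq_comp, mul_apply_eq_comp, hxy]

/-- If `B` is injective, then `reduction B A` has the graph that defines it. -/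
lemma reduction_graph (B : H →L[ℂ] H) (hB : IsSelfAdjoint B) (h0 : Function.Injective B)
    (A : H →ₗ.[ℂ] H) : (reduction B A).graph = reductionGraph B A := by
  have hR := rootAbs_injective B hB h0
  refine Submodule.toLinearPMap_graph_eq _ ?_
  rintro ⟨k, l⟩ ⟨x, w, h1, h2, h3⟩ hk
  simp only at h2 h3 hk
  subst hk
  have hx : (x : H) = 0 := hR (by rw [← T_toK, ← h2]; simp)
  have hx' : x = 0 := Subtype.ext hx
  have hw : w = 0 := hR (by rw [h1, hx']; simp)
  refine T_injective B ?_
  rw [h3, hw]; simp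

end Spectral

/-! ### Extensions and spaces of boundary values -/

section Extensions

variable {H : Type*} [NormedAddCommGroup H] [InnerProductSpace ℂ H] [CompleteSpace H]

/-- The closed (proper) extensions of a symmetric operator `A` in `H`: the closed operators lying
between `A` and `A*`. -/
def closedExtensions (A : H →ₗ.[ℂ] H) : Set (H →ₗ.[ℂ] H) :=
  {A' | A ≤ A' ∧ A' ≤ A† ∧ A'.IsClosed}

/-- The selfadjoint extensions of `A` in `H`. -/
def selfAdjointExtensions (A : H →ₗ.[ℂ] H) : Set (H →ₗ.[ℂ] H) :=
  {A' | A ≤ A' ∧ IsSelfAdjoint A'}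

/-- The closed (proper) extensions of a symmetric operator `S` in the Krein space `K`: the closed
operators lying between `S` and its Krein space adjoint. -/
def kreinClosedExtensions (B : H →L[ℂ] H) (S : K B →ₗ.[ℂ] K B) : Set (K B →ₗ.[ℂ] K B) :=
  {S' | S ≤ S' ∧ S' ≤ kreinAdjoint B S ∧ S'.IsClosed}

/-- The extensions of `S` that are selfadjoint in the Krein space `K`. -/
def kreinSelfAdjointExtensions (B : H →L[ℂ] H) (S : K B →ₗ.[ℂ] K B) :
    Set (K B →ₗ.[ℂ] K B) :=
  {S' | S ≤ S' ∧ IsKreinSelfAdjoint B S'}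

variable {E Ω : Type*} [NormedAddCommGroup E] [InnerProductSpace ℂ E]
  [NormedAddCommGroup Ω] [InnerProductSpace ℂ Ω] [CompleteSpace Ω]

/-- `{Ω, Ĵ, Γ₁, Γ₂}` is a space of boundary values for the adjoint `R` of a symmetric operator,
the adjoint being taken with respect to the inner product `form`. In a Hilbert space `form` is the
inner product and `Ĵ = 1`. Boundedness refers to the graph norm of `R`. -/
structure IsBoundaryValueSpace (form : E → E → ℂ) (R : E →ₗ.[ℂ] E) (Jhat : Ω →L[ℂ] Ω)
    (Γ₁ Γ₂ : R.domain →ₗ[ℂ] Ω) : Prop where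
  involution : Jhat ∘L Jhat = 1
  involution_selfAdjoint : IsSelfAdjoint Jhat
  bounded : ∃ C : ℝ, ∀ x : R.domain,
    ‖Γ₁ x‖ ≤ C * √(‖(x : E)‖ ^ 2 + ‖R x‖ ^ 2) ∧ ‖Γ₂ x‖ ≤ C * √(‖(x : E)‖ ^ 2 + ‖R x‖ ^ 2)
  green : ∀ x y : R.domain, form (R x) y - form x (R y) =
    inner ℂ (Γ₁ x) (Jhat (Γ₂ y)) - inner ℂ (Γ₂ x) (Jhat (Γ₁ y))
  surjective : Function.Surjective fun x : R.domain => (Γ₁ x, Γ₂ x)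

/-- The restriction of `R` given by a linear relation `θ` in `Ω`, with domain
`{x ∈ D(R) : (Γ₂ x, Γ₁ x) ∈ θ}`. -/
def boundaryRestriction (R : E →ₗ.[ℂ] E) (Γ₁ Γ₂ : R.domain →ₗ[ℂ] Ω)
    (θ : Submodule ℂ (Ω × Ω)) : E →ₗ.[ℂ] E :=
  R.domRestrict ((θ.comap (Γ₂.prod Γ₁)).map R.domain.subtype)

end Extensions

end PencilReduction

end

open PencilReduction

/-!
The embedding `toK : H → K` has an adjoint `toKAdjoint = |B|^{1/2} J T : K → H` with respect to the
indefinite inner product of `K` and the inner product of `H`. In these terms the reduction of an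
operator `A` loses all reference to `J` and `|B|^{1/2}`: its graph consists of the pairs
`(toK x, k)` with `(x, toKAdjoint k)` in the graph of `A` (`mem_graph_reduction`). Moreover
`toKAdjoint ∘ toK = B`, which links the reduction to the pencil `A - l B`.

Two finiteness facts carry the proof. As both deficiency indices are finite, `D(A*)` is
finite-dimensional modulo `D(A)` (`exists_graph_adjoint_le_graph_sup`), so all operators between
`A` and `A*` are closed. As `A - l B` is closed and bounded below, its range is closed, and the
orthogonal complement of the range, the kernel of `A* - l B`, meets `D(A)` only in zero and is
therefore finite-dimensional. Consequently the range of `A - l B` and the dense range of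
`|B|^{1/2}` together span `H` (`pencilRange_sup_range`), and every vector in the domain of an
extension `A'` of `A` is the sum of a vector of `D(A)` and one that `A'` maps into the range of
`|B|^{1/2}` (`exists_decomposition`). This decomposition makes the reduction injective on
extensions of `A` and shows which operator lies over a given extension of `S`.

The analytic core is that the adjoint of the reduction of `A'` is the reduction of `A'*`
(`kreinAdjointGraph_reduction`). If `(u, w)` is in the graph of the adjoint, then
`toKAdjoint (w - l u)` is orthogonal to the kernel of `A' - l B`, so it equals `(A'* - l B) x₀` for
some `x₀`. Then `u - x₀` is orthogonal to the preimage under `toKAdjoint` of the range of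
`A' - l B`, which has finite codimension, and it follows that `u - x₀` lies in the
finite-dimensional kernel of `A'* - l B`. Density of the domain of `S`, closedness of the reductions and the
correspondence of selfadjoint extensions are consequences. The boundary maps vanish exactly on
`D(A)` and have finite-dimensional range, so on the graph of `S*` they have a closed kernel, the
graph of `S`, and are continuous.
-/

open PencilReduction

namespace PencilReduction

/-! ### The sign and the square root of `B` -/

section Sign

variable {H : Type*} [NormedAddCommGroup H] [InnerProductSpace ℂ H] [CompleteSpace H]
  {B : H →L[ℂ] H}

lemma cfc_mem_spectralSubspace (B : H →L[ℂ] H) {U : Set ℝ} {f : ℝ → ℝ} (hf : Continuous f)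
    (hfU : ∀ t, t ∉ U → f t = 0) (x : H) : (cfc f B : H →L[ℂ] H) x ∈ spectralSubspace B U :=
  Submodule.le_topologicalClosure _ <| Submodule.mem_iSup_of_mem
    (⟨f, hf, hfU⟩ : {f : ℝ → ℝ // Continuous f ∧ ∀ t, t ∉ U → f t = 0}) ⟨x, rfl⟩

lemma inner_cfc_left (f : ℝ → ℝ) (x y : H) :
    inner ℂ ((cfc f B : H →L[ℂ] H) x) y = inner ℂ x ((cfc f B : H →L[ℂ] H) y) := by
  have h : IsSelfAdjoint (cfc f B : H →L[ℂ] H) := IsSelfAdjoint.cfc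
  exact h.isSymmetric x y

lemma spectralProj_cfc_of_vanish_off (B : H →L[ℂ] H) {U : Set ℝ} {f : ℝ → ℝ} (hf : Continuous f)
    (hfU : ∀ t, t ∉ U → f t = 0) (x : H) :
    spectralProj B U ((cfc f B : H →L[ℂ] H) x) = (cfc f B : H →L[ℂ] H) x :=
  Submodule.starProjection_eq_self_iff.2 (cfc_mem_spectralSubspace B hf hfU x)

lemma spectralProj_cfc_of_vanish_on (B : H →L[ℂ] H) {U : Set ℝ} {g : ℝ → ℝ}
    (hg : Continuous g) (hgU : ∀ t ∈ U, g t = 0) (x : H) :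
    spectralProj B U ((cfc g B : H →L[ℂ] H) x) = 0 := by
  refine (Submodule.starProjection_apply_eq_zero_iff _).2 ?_
  rw [spectralSubspace, Submodule.orthogonal_closure, ← Submodule.iInf_orthogonal,
    Submodule.mem_iInf]
  rintro ⟨f, hf, hfU⟩ _ ⟨y, rfl⟩
  have h0 : (cfc f B : H →L[ℂ] H) * cfc g B = 0 := by
    rw [← cfc_mul f g B hf.continuousOn hg.continuousOn]
    have : (fun t => f t * g t) = fun _ => 0 := by
      funext t
      by_cases ht : t ∈ U
      · rw [hgU t ht, mul_zero]
      · rw [hfU t ht, zero_mul]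
    rw [this, cfc_const_zero]
  change inner ℂ ((cfc f B : H →L[ℂ] H) y) _ = 0
  rw [inner_cfc_left, ← mul_apply_eq_comp, h0]
  simp

/-- `|B|^{1/2}` is selfadjoint. -/
lemma inner_rootAbs_left (x y : H) : inner ℂ (rootAbs B x) y = inner ℂ x (rootAbs B y) :=
  inner_cfc_left _ x y

lemma denseRange_rootAbs (hB : IsSelfAdjoint B) (h0 : Function.Injective B) :
    DenseRange (rootAbs B) := by
  have h : (LinearMap.range (rootAbs B).toLinearMap)ᗮ = ⊥ := by
    refine (Submodule.eq_bot_iff _).2 fun y hy => ?_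
    refine rootAbs_injective B hB h0 ?_
    rw [map_zero]
    refine inner_self_eq_zero (𝕜 := ℂ).1 ?_
    rw [← inner_rootAbs_left]
    exact hy _ ⟨_, rfl⟩
  have := (Submodule.dense_iff_topologicalClosure_eq_top).2
    ((Submodule.topologicalClosure_eq_top_iff).2 h)
  exact this

lemma rootAbs_eq_add (B : H →L[ℂ] H) :
    rootAbs B = cfc (fun t : ℝ => √(max t 0)) B + cfc (fun t : ℝ => √(max (-t) 0)) B := by
  rw [rootAbs, ← cfc_add B _ _ (by fun_prop) (by fun_prop)]
  refine cfc_congr fun t _ => ?_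
  rcases le_total t 0 with h | h
  · simp [abs_of_nonpos h, h]
  · simp [abs_of_nonneg h, h]

lemma spectralProj_Ioi_rootAbs (B : H →L[ℂ] H) (x : H) :
    spectralProj B (Set.Ioi 0) (rootAbs B x) = (cfc (fun t : ℝ => √(max t 0)) B : H →L[ℂ] H) x := by
  rw [rootAbs_eq_add B, add_apply, map_add,
    spectralProj_cfc_of_vanish_off B (by fun_prop), spectralProj_cfc_of_vanish_on B (by fun_prop),
    add_zero]
  · intro t ht; simp [le_of_lt (Set.mem_Ioi.1 ht)]
  · intro t ht; simp [not_lt.1 (fun h => ht (Set.mem_Ioi.2 h))]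

lemma spectralProj_Iio_rootAbs (B : H →L[ℂ] H) (x : H) :
    spectralProj B (Set.Iio 0) (rootAbs B x) =
      (cfc (fun t : ℝ => √(max (-t) 0)) B : H →L[ℂ] H) x := by
  rw [rootAbs_eq_add B, add_apply, map_add,
    spectralProj_cfc_of_vanish_on B (by fun_prop), spectralProj_cfc_of_vanish_off B (by fun_prop),
    zero_add]
  · intro t ht; simp [not_lt.1 (fun h => ht (Set.mem_Iio.2 h))]
  · intro t ht; simp [le_of_lt (Set.mem_Iio.1 ht)]

lemma sgn_rootAbs (B : H →L[ℂ] H) (x : H) :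
    sgn B (rootAbs B x) = (cfc (fun t : ℝ => √(max t 0) - √(max (-t) 0)) B : H →L[ℂ] H) x := by
  rw [sgn, sub_apply, spectralProj_Ioi_rootAbs B,
    spectralProj_Iio_rootAbs B, cfc_sub _ _ B (by fun_prop) (by fun_prop), sub_apply]

/-- `J` is selfadjoint. -/
lemma inner_sgn_left (x y : H) : inner ℂ (sgn B x) y = inner ℂ x (sgn B y) := by
  simp only [sgn, spectralProj, sub_apply, inner_sub_left, inner_sub_right,
    Submodule.inner_starProjection_left_eq_right]

/-- `J` commutes with `|B|^{1/2}`: on the range of `|B|^{1/2}` it is a function of `B`. -/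
lemma rootAbs_sgn (B : H →L[ℂ] H) (x : H) :
    rootAbs B (sgn B x) = sgn B (rootAbs B x) := by
  refine ext_inner_right ℂ fun y => ?_
  rw [inner_rootAbs_left, inner_sgn_left, sgn_rootAbs B, sgn_rootAbs B, inner_cfc_left]

/-- The factorization `B = J |B|`. -/
lemma sgn_rootAbs_rootAbs (hB : IsSelfAdjoint B) (x : H) :
    sgn B (rootAbs B (rootAbs B x)) = B x := by
  rw [sgn_rootAbs B, rootAbs, ← mul_apply_eq_comp, ← cfc_mul _ _ B (by fun_prop) (by fun_prop)]
  conv_rhs => rw [← cfc_id ℝ B]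
  congr 1
  refine cfc_congr fun t _ => ?_
  rcases le_total t 0 with h | h
  · simp [abs_of_nonpos h, h, Real.mul_self_sqrt (neg_nonneg.2 h)]
  · simp [abs_of_nonneg h, h, Real.mul_self_sqrt h]

/-- If `B` is injective, then `J² = 1`. On the dense range of `|B|^{1/2}` this is seen from the
functional calculus. -/
lemma sgn_sgn (hB : IsSelfAdjoint B) (h0 : Function.Injective B) (x : H) :
    sgn B (sgn B x) = x := by
  have h : (fun x => sgn B (sgn B x)) = id := by
    refine (denseRange_rootAbs hB h0).equalizer (by fun_prop) continuous_id ?_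
    funext y
    simp only [Function.comp_apply, id]
    rw [sgn_rootAbs B, sgn, sub_apply, cfc_sub _ _ B (by fun_prop) (by fun_prop), sub_apply,
      map_sub, map_sub, spectralProj_cfc_of_vanish_off B (by fun_prop),
      spectralProj_cfc_of_vanish_on B (by fun_prop), spectralProj_cfc_of_vanish_on B (by fun_prop),
      spectralProj_cfc_of_vanish_off B (by fun_prop), rootAbs_eq_add B, add_apply]
    · abel
    · intro t ht; simp [not_lt.1 (fun h => ht (Set.mem_Iio.2 h))]
    · intro t ht; simp [le_of_lt (Set.mem_Iio.1 ht)]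
    · intro t ht; simp [le_of_lt (Set.mem_Ioi.1 ht)]
    · intro t ht; simp [not_lt.1 (fun h => ht (Set.mem_Ioi.2 h))]
  exact congrFun h x

end Sign

/-! ### The Krein space `K` and the adjoint of the embedding of `H` -/

section KreinSpace

variable {H : Type*} [NormedAddCommGroup H] [InnerProductSpace ℂ H] [CompleteSpace H]
  {B : H →L[ℂ] H}

lemma isometry_T (B : H →L[ℂ] H) : Isometry (T B) :=
  AddMonoidHomClass.isometry_of_norm (T B) fun _ => rfl

lemma T_surjective (hB : IsSelfAdjoint B) (h0 : Function.Injective B) :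
    Function.Surjective (T B) := by
  have hd : Dense (Set.range (T B)) :=
    (denseRange_rootAbs hB h0).mono (by rintro _ ⟨x, rfl⟩; exact ⟨toK B x, T_toK B x⟩)
  have hc : IsClosed (Set.range (T B)) := (isometry_T B).isClosedEmbedding.isClosed_range
  rw [← Set.range_eq_univ, ← hc.closure_eq, hd.closure_eq]

lemma toK_injective (hB : IsSelfAdjoint B) (h0 : Function.Injective B) :
    Function.Injective (toK B) := by
  intro x y h
  apply rootAbs_injective B hB h0
  rw [← T_toK, ← T_toK, h]

/-- The adjoint `K → H`, with respect to the indefinite inner product of `K` and the inner product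
of `H`, of the embedding `toK` of `H` into `K`. It extends `B`, and `T⁻¹ J |B|^{-1/2}` is its
inverse. -/
noncomputable def toKAdjoint (B : H →L[ℂ] H) : K B →ₗ[ℂ] H :=
  (rootAbs B : H →ₗ[ℂ] H) ∘ₗ (sgn B : H →ₗ[ℂ] H) ∘ₗ T B

lemma toKAdjoint_apply (k : K B) : toKAdjoint B k = rootAbs B (sgn B (T B k)) := rfl

lemma toKAdjoint_toK (hB : IsSelfAdjoint B) (x : H) : toKAdjoint B (toK B x) = B x := by
  rw [toKAdjoint_apply, T_toK, rootAbs_sgn, sgn_rootAbs_rootAbs hB]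

lemma range_toKAdjoint (hB : IsSelfAdjoint B) (h0 : Function.Injective B) (w : H) :
    ∃ k, T B k = sgn B w ∧ toKAdjoint B k = rootAbs B w := by
  obtain ⟨k, hk⟩ := T_surjective hB h0 (sgn B w)
  exact ⟨k, hk, by rw [toKAdjoint_apply, hk, sgn_sgn hB h0]⟩

lemma kreinForm_toK_left (x : H) (k : K B) :
    kreinForm B (toK B x) k = inner ℂ x (toKAdjoint B k) := by
  rw [kreinForm, T_toK, inner_sgn_left, inner_rootAbs_left, toKAdjoint_apply]

lemma kreinForm_toK_right (k : K B) (x : H) :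
    kreinForm B k (toK B x) = inner ℂ (toKAdjoint B k) x := by
  rw [kreinForm, T_toK, ← inner_rootAbs_left, toKAdjoint_apply]

lemma mem_reductionGraph (hB : IsSelfAdjoint B) (h0 : Function.Injective B) (A : H →ₗ.[ℂ] H)
    (k l : K B) :
    (k, l) ∈ reductionGraph B A ↔ ∃ x, toK B x = k ∧ (x, toKAdjoint B l) ∈ A.graph := by
  constructor
  · rintro ⟨x, w, h1, h2, h3⟩
    refine ⟨x, h2.symm, ?_⟩
    rw [LinearPMap.mem_graph_iff]
    refine ⟨x, rfl, ?_⟩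
    rw [← h1, toKAdjoint_apply, h3, sgn_sgn hB h0]
  · rintro ⟨x, h1, h2⟩
    obtain ⟨x', rfl, h⟩ := (LinearPMap.mem_graph_iff _).1 h2
    exact ⟨x', sgn B (T B l), h.symm, h1.symm, (sgn_sgn hB h0 _).symm⟩

/-- The graph of `T⁻¹ J |B|^{-1/2} A`, without reference to `J` and `|B|^{1/2}`. -/
lemma mem_graph_reduction (hB : IsSelfAdjoint B) (h0 : Function.Injective B) (A : H →ₗ.[ℂ] H)
    (k l : K B) :
    (k, l) ∈ (reduction B A).graph ↔ ∃ x, toK B x = k ∧ (x, toKAdjoint B l) ∈ A.graph := by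
  rw [reduction_graph B hB h0, mem_reductionGraph hB h0]

lemma toK_mem_graph_reduction (hB : IsSelfAdjoint B) (h0 : Function.Injective B)
    (A : H →ₗ.[ℂ] H) (x : H) (l : K B) :
    (toK B x, l) ∈ (reduction B A).graph ↔ (x, toKAdjoint B l) ∈ A.graph := by
  rw [mem_graph_reduction hB h0]
  constructor
  · rintro ⟨y, h, hy⟩
    rwa [← toK_injective hB h0 h]
  · exact fun h => ⟨x, rfl, h⟩

lemma reduction_mono (hB : IsSelfAdjoint B) (h0 : Function.Injective B) {A A' : H →ₗ.[ℂ] H}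
    (h : A ≤ A') : reduction B A ≤ reduction B A' := by
  refine LinearPMap.le_of_le_graph ?_
  rintro ⟨k, l⟩ hkl
  rw [mem_graph_reduction hB h0] at hkl ⊢
  obtain ⟨x, hx, hxl⟩ := hkl
  exact ⟨x, hx, LinearPMap.le_graph_of_le h hxl⟩

/-- The indefinite inner product of `K` is nondegenerate. -/
lemma eq_zero_of_kreinForm_eq_zero (hB : IsSelfAdjoint B) (h0 : Function.Injective B) {l : K B}
    {D : Set (K B)} (hD : Dense D) (h : ∀ k ∈ D, kreinForm B k l = 0) : l = 0 := by
  obtain ⟨m, hm⟩ := T_surjective hB h0 (sgn B (T B l))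
  have hm0 : m = 0 := by
    refine hD.eq_zero_of_inner_right ℂ fun k hk => ?_
    rw [← h k hk, kreinForm, inner_sgn_left, ← hm]
    rfl
  refine T_injective B ?_
  rw [← sgn_sgn hB h0 (T B l), ← hm, hm0]
  simp

lemma mem_kreinAdjointGraph (S : K B →ₗ.[ℂ] K B) (p : K B × K B) :
    p ∈ kreinAdjointGraph B S ↔
      ∀ k l, (k, l) ∈ S.graph → kreinForm B l p.1 = kreinForm B k p.2 := by
  constructor
  · intro h k l hkl
    obtain ⟨x, rfl, rfl⟩ := (LinearPMap.mem_graph_iff _).1 hkl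
    exact h x
  · exact fun h x => h _ _ (S.mem_graph x)

lemma graph_kreinAdjoint (hB : IsSelfAdjoint B) (h0 : Function.Injective B)
    {S : K B →ₗ.[ℂ] K B} (hS : Dense (S.domain : Set (K B))) :
    (kreinAdjoint B S).graph = kreinAdjointGraph B S := by
  refine Submodule.toLinearPMap_graph_eq _ ?_
  rintro ⟨k, l⟩ h hk
  simp only at hk
  subst hk
  refine eq_zero_of_kreinForm_eq_zero hB h0 hS fun x hx => ?_
  have := h ⟨x, hx⟩
  simp only at this
  rw [← this]
  simp [kreinForm]

lemma isClosed_kreinAdjointGraph (S : K B →ₗ.[ℂ] K B) :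
    IsClosed (kreinAdjointGraph B S : Set (K B × K B)) := by
  have : (kreinAdjointGraph B S : Set (K B × K B)) =
      ⋂ x : S.domain, {p | kreinForm B (S x) p.1 = kreinForm B x p.2} := by
    ext p; simp [kreinAdjointGraph]
  rw [this]
  have hT := (isometry_T B).continuous
  refine isClosed_iInter fun x => isClosed_eq ?_ ?_
  · exact continuous_const.inner (hT.comp continuous_fst)
  · exact continuous_const.inner (hT.comp continuous_snd)

lemma isClosed_kreinAdjoint (hB : IsSelfAdjoint B) (h0 : Function.Injective B)
    {S : K B →ₗ.[ℂ] K B} (hS : Dense (S.domain : Set (K B))) :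
    (kreinAdjoint B S).IsClosed := by
  rw [LinearPMap.IsClosed, graph_kreinAdjoint hB h0 hS]
  exact isClosed_kreinAdjointGraph S

lemma kreinAdjoint_anti (hB : IsSelfAdjoint B) (h0 : Function.Injective B)
    {S S' : K B →ₗ.[ℂ] K B} (hS : Dense (S.domain : Set (K B))) (h : S ≤ S') :
    kreinAdjoint B S' ≤ kreinAdjoint B S := by
  refine LinearPMap.le_of_le_graph ?_
  rw [graph_kreinAdjoint hB h0 hS, graph_kreinAdjoint hB h0 (hS.mono h.1)]
  intro p hp
  rw [mem_kreinAdjointGraph] at hp ⊢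
  exact fun k l hkl => hp k l (LinearPMap.le_graph_of_le h hkl)

end KreinSpace

/-! ### Finite-dimensional extensions of closed subspaces -/

section FiniteDimensional

variable {V W : Type*} [AddCommGroup V] [Module ℂ V] [AddCommGroup W] [Module ℂ W]

/-- A subspace exceeds its intersection with the kernel of a map to a finite-dimensional space by a
finite-dimensional space only. -/
lemma exists_finiteDimensional_le_inf_ker_sup [FiniteDimensional ℂ W] (L : Submodule ℂ V)
    (f : V →ₗ[ℂ] W) :
    ∃ F : Submodule ℂ V, FiniteDimensional ℂ F ∧ L ≤ (L ⊓ LinearMap.ker f) ⊔ F := by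
  obtain ⟨F, hF⟩ := Submodule.exists_isCompl (LinearMap.ker (f.domRestrict L))
  have hfin : FiniteDimensional ℂ F := by
    refine Module.Finite.of_injective ((f.domRestrict L).domRestrict F) ?_
    rw [← LinearMap.ker_eq_bot, LinearMap.ker_domRestrict, ← Submodule.disjoint_iff_comap_eq_bot]
    exact hF.disjoint.symm
  refine ⟨F.map L.subtype, inferInstance, fun x hx => ?_⟩
  obtain ⟨y, hy, z, hz, hyz⟩ := Submodule.mem_sup.1
    (hF.sup_eq_top.ge (Submodule.mem_top (x := ⟨x, hx⟩)))
  refine Submodule.mem_sup.2 ⟨y, ⟨y.2, hy⟩, z, ⟨z, hz, rfl⟩, congrArg Subtype.val hyz⟩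

lemma finiteDimensional_of_le_sup {N G F : Submodule ℂ V} [FiniteDimensional ℂ F]
    (h : N ≤ G ⊔ F) (hNG : Disjoint N G) : FiniteDimensional ℂ N := by
  have hmap : ∀ x : N, G.mkQ.domRestrict N x ∈ F.map G.mkQ := by
    intro x
    change G.mkQ x ∈ F.map G.mkQ
    obtain ⟨g, hg, f, hf, hgf⟩ := Submodule.mem_sup.1 (h x.2)
    refine ⟨f, hf, ?_⟩
    rw [← hgf, map_add, Submodule.mkQ_apply G g, (Submodule.Quotient.mk_eq_zero G).2 hg, zero_add]
  refine Module.Finite.of_injective ((G.mkQ.domRestrict N).codRestrict (F.map G.mkQ) hmap) ?_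
  rw [← LinearMap.ker_eq_bot, LinearMap.ker_codRestrict, LinearMap.ker_domRestrict,
    Submodule.ker_mkQ, ← Submodule.disjoint_iff_comap_eq_bot]
  exact hNG

lemma isClosed_of_le_of_le_sup {E : Type*} [NormedAddCommGroup E] [NormedSpace ℂ E]
    {G L F : Submodule ℂ E} [FiniteDimensional ℂ F] (hG : IsClosed (G : Set E)) (hGL : G ≤ L)
    (hL : L ≤ G ⊔ F) : IsClosed (L : Set E) := by
  have : L = G ⊔ F ⊓ L := by rw [← sup_inf_assoc_of_le _ hGL, inf_eq_right.2 hL]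
  rw [this]
  exact Submodule.isClosed_sup_finiteDimensional _ _ hG

lemma continuous_of_isClosed_ker {E W : Type*} [NormedAddCommGroup E] [NormedSpace ℂ E]
    [NormedAddCommGroup W] [NormedSpace ℂ W] [FiniteDimensional ℂ W] (f : E →ₗ[ℂ] W)
    (hf : IsClosed (LinearMap.ker f : Set E)) : Continuous f := by
  have : FiniteDimensional ℂ (E ⧸ LinearMap.ker f) :=
    Module.Finite.of_injective ((LinearMap.ker f).liftQ f le_rfl)
      (LinearMap.ker_eq_bot.1 (Submodule.ker_liftQ_eq_bot _ _ _ le_rfl))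
  have hq : Continuous (Submodule.Quotient.mk (p := LinearMap.ker f)) := continuous_quot_mk
  exact (((LinearMap.ker f).liftQ f le_rfl).continuous_of_finiteDimensional).comp hq

end FiniteDimensional

/-! ### Operators between a symmetric operator and its adjoint -/

section Adjoint

variable {H : Type*} [NormedAddCommGroup H] [InnerProductSpace ℂ H] [CompleteSpace H]

lemma mem_graph_adjoint {A : H →ₗ.[ℂ] H} (hA : Dense (A.domain : Set H)) (p : H × H) :
    p ∈ A†.graph ↔ ∀ x y, (x, y) ∈ A.graph → inner ℂ y p.1 = inner ℂ x p.2 := by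
  rw [LinearPMap.adjoint_graph_eq_graph_adjoint hA, Submodule.mem_adjoint_iff]
  simp only [sub_eq_zero]

lemma adjoint_anti {A A' : H →ₗ.[ℂ] H} (hA : Dense (A.domain : Set H)) (h : A ≤ A') :
    A'† ≤ A† := by
  refine LinearPMap.le_of_le_graph fun p hp => ?_
  rw [mem_graph_adjoint (hA.mono h.1)] at hp
  rw [mem_graph_adjoint hA]
  exact fun x y hxy => hp x y (LinearPMap.le_graph_of_le h hxy)

/-- A pair that pairs with the graph of the adjoint of a closed operator as an element of the graph
of the operator does, lies in this graph: the second orthogonal complement of a closed subspace of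
`H × H` is the subspace itself. -/
lemma mem_graph_of_inner_adjoint {A : H →ₗ.[ℂ] H} (hA : Dense (A.domain : Set H))
    (hc : A.IsClosed) {h k : H}
    (hhk : ∀ x y, (x, y) ∈ A†.graph → inner ℂ y h = inner ℂ x k) : (h, k) ∈ A.graph := by
  let e := WithLp.prodContinuousLinearEquiv 2 ℂ H H
  let G : Submodule ℂ (WithLp 2 (H × H)) := A.graph.comap e.toLinearMap
  have hG : IsClosed (G : Set (WithLp 2 (H × H))) := hc.preimage e.continuous
  have : CompleteSpace G := hG.completeSpace_coe
  have key : WithLp.toLp 2 (h, k) ∈ Gᗮᗮ := by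
    intro q hq
    have h1 : (q.snd, -q.fst) ∈ A†.graph := by
      rw [mem_graph_adjoint hA]
      intro x y hxy
      have := hq (WithLp.toLp 2 (x, y)) hxy
      rw [WithLp.prod_inner_apply] at this
      change inner ℂ x q.fst + inner ℂ y q.snd = 0 at this
      rw [inner_neg_right]
      linear_combination this
    have := hhk _ _ h1
    rw [inner_neg_left] at this
    rw [WithLp.prod_inner_apply]
    change inner ℂ q.fst h + inner ℂ q.snd k = 0
    linear_combination -this
  rw [Submodule.orthogonal_orthogonal] at key
  exact key

lemma adjoint_adjoint {A : H →ₗ.[ℂ] H} (hA : Dense (A.domain : Set H)) (hc : A.IsClosed)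
    (hA' : Dense (A†.domain : Set H)) : A†† = A := by
  refine LinearPMap.eq_of_eq_graph (le_antisymm ?_ ?_)
  · rintro ⟨h, k⟩ hp
    rw [mem_graph_adjoint hA'] at hp
    exact mem_graph_of_inner_adjoint hA hc hp
  · intro p hp
    rw [mem_graph_adjoint hA']
    intro x y hxy
    have := (mem_graph_adjoint hA _).1 hxy _ _ hp
    rw [← inner_conj_symm, ← inner_conj_symm x, this]

/-- If the orthogonal complements of the ranges of `A - μ` and `A - conj μ` are finite-dimensional,
then so is `D(A*)` modulo `D(A)`. -/
lemma exists_graph_adjoint_le_graph_sup {A : H →ₗ.[ℂ] H} (hA : Dense (A.domain : Set H))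
    (hs : A ≤ A†) {p m : ℕ} (h : HasDeficiencyIndices A p m) :
    ∃ F : Submodule ℂ (H × H), FiniteDimensional ℂ F ∧ A†.graph ≤ A.graph ⊔ F := by
  obtain ⟨μ, -, h1, h2⟩ := h
  have f1 : FiniteDimensional ℂ (H ⧸ LinearMap.range (pencil A 1 μ)) :=
    Module.rank_lt_aleph0_iff.1 (by rw [← defect, h1]; exact Cardinal.natCast_lt_aleph0)
  have f2 : FiniteDimensional ℂ (H ⧸ LinearMap.range (pencil A 1 (conj μ))) :=
    Module.rank_lt_aleph0_iff.1 (by rw [← defect, h2]; exact Cardinal.natCast_lt_aleph0)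
  set M := LinearMap.range (pencil A 1 μ)
  set M' := LinearMap.range (pencil A 1 (conj μ))
  have f3 : FiniteDimensional ℂ M'ᗮ := by
    refine Module.Finite.of_injective (M'.mkQ.domRestrict M'ᗮ) ?_
    rw [← LinearMap.ker_eq_bot, LinearMap.ker_domRestrict, Submodule.ker_mkQ,
      ← Submodule.disjoint_iff_comap_eq_bot]
    exact (Submodule.orthogonal_disjoint M').symm
  obtain ⟨F, hF, hle⟩ := exists_finiteDimensional_le_inf_ker_sup A†.graph
    (M.mkQ ∘ₗ (LinearMap.snd ℂ H H - μ • LinearMap.fst ℂ H H))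
  refine ⟨M'ᗮ.map (LinearMap.id.prod (μ • LinearMap.id)) ⊔ F, inferInstance, ?_⟩
  rw [← sup_assoc]
  refine hle.trans (sup_le_sup_right ?_ _)
  rintro ⟨h, k⟩ ⟨hhk, hker⟩
  obtain ⟨x, hx⟩ := (Submodule.Quotient.mk_eq_zero M).1 (show M.mkQ (k - μ • h) = 0 from hker)
  replace hx : A x - μ • (x : H) = k - μ • h := hx
  refine Submodule.mem_sup.2 ⟨(x, A x), A.mem_graph x, (h - x, k - A x), ?_, by simp⟩
  have hd : ((h - x, k - A x) : H × H) ∈ A†.graph := by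
    have := A†.graph.sub_mem hhk (LinearPMap.le_graph_of_le hs (A.mem_graph x))
    simpa using this
  have hμ : k - A x = μ • (h - x) := by
    rw [smul_sub, sub_eq_sub_iff_add_eq_add, ← sub_eq_sub_iff_add_eq_add.1 hx, add_comm]
  refine ⟨h - x, ?_, by simp [hμ]⟩
  rintro _ ⟨z, rfl⟩
  have := (mem_graph_adjoint hA _).1 hd _ _ (A.mem_graph z)
  change inner ℂ (A z - conj μ • (z : H)) (h - x) = 0
  rw [inner_sub_left, inner_smul_left, this, hμ, inner_smul_right]
  simp

end Adjoint

/-! ### The pencil `A - l B` and adjoints of reductions -/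

section Pencil

variable {H : Type*} [NormedAddCommGroup H] [InnerProductSpace ℂ H]

/-- The continuous map `(x, y) ↦ y - l B x`, which on the graph of `A` is `A - l B`. -/
noncomputable def pencilMap (B : H →L[ℂ] H) (l : ℝ) : H × H →L[ℂ] H :=
  ContinuousLinearMap.snd ℂ H H - (l : ℂ) • B ∘L ContinuousLinearMap.fst ℂ H H

/-- The range of `A - l B`. -/
noncomputable def pencilRange (A : H →ₗ.[ℂ] H) (B : H →L[ℂ] H) (l : ℝ) : Submodule ℂ H :=
  A.graph.map (pencilMap B l).toLinearMap

lemma pencilRange_mono {A A' : H →ₗ.[ℂ] H} (B : H →L[ℂ] H) (l : ℝ) (h : A ≤ A') :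
    pencilRange A B l ≤ pencilRange A' B l :=
  Submodule.map_mono (LinearPMap.le_graph_of_le h)

lemma mem_pencilRange {A : H →ₗ.[ℂ] H} {B : H →L[ℂ] H} {l : ℝ} {z : H} :
    z ∈ pencilRange A B l ↔ ∃ x y, (x, y) ∈ A.graph ∧ y - (l : ℂ) • B x = z := by
  constructor
  · rintro ⟨⟨x, y⟩, h, rfl⟩
    exact ⟨x, y, h, rfl⟩
  · rintro ⟨x, y, h, rfl⟩
    exact ⟨(x, y), h, rfl⟩

variable [CompleteSpace H]

/-- The standing assumptions: `A` is closed, densely defined and symmetric, with `D(A*)`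
finite-dimensional modulo `D(A)`; `B` is selfadjoint and injective; and `A - l B` is bounded
below. -/
structure IsRegularPencil (A : H →ₗ.[ℂ] H) (B : H →L[ℂ] H) (l : ℝ) : Prop where
  dense : Dense (A.domain : Set H)
  symm : A ≤ A†
  closed : A.IsClosed
  finite : ∃ F : Submodule ℂ (H × H), FiniteDimensional ℂ F ∧ A†.graph ≤ A.graph ⊔ F
  selfAdjoint : IsSelfAdjoint B
  injective : Function.Injective B
  regular : (l : ℂ) ∈ regularPoints A B

/-- The orthogonal complement of the range of `A - l B` is the kernel of `A* - l B`. -/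
lemma mem_orthogonal_pencilRange {A : H →ₗ.[ℂ] H} {B : H →L[ℂ] H} {l : ℝ}
    (hA : Dense (A.domain : Set H)) (hB : IsSelfAdjoint B) {h : H} :
    h ∈ (pencilRange A B l)ᗮ ↔ (h, (l : ℂ) • B h) ∈ A†.graph := by
  rw [mem_graph_adjoint hA, Submodule.mem_orthogonal]
  have hBs : ∀ x : H, inner ℂ (B x) h = inner ℂ x (B h) := fun x => hB.isSymmetric x h
  have key : ∀ x y : H, inner ℂ (y - (l : ℂ) • B x) h = 0 ↔
      inner ℂ y h = inner ℂ x ((l : ℂ) • B h) := by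
    intro x y
    rw [inner_sub_left, inner_smul_left, inner_smul_right, Complex.conj_ofReal, hBs, sub_eq_zero]
  constructor
  · exact fun H x y hxy => (key x y).1 (H _ (mem_pencilRange.2 ⟨x, y, hxy, rfl⟩))
  · rintro H _ hu
    obtain ⟨x, y, hxy, rfl⟩ := mem_pencilRange.1 hu
    exact (key x y).2 (H x y hxy)

namespace IsRegularPencil

variable {A : H →ₗ.[ℂ] H} {B : H →L[ℂ] H} {l : ℝ}

lemma exists_bound (h : IsRegularPencil A B l) :
    ∃ C : ℝ, 0 < C ∧ ∀ x y, (x, y) ∈ A.graph → C * ‖x‖ ≤ ‖y - (l : ℂ) • B x‖ := by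
  obtain ⟨C, hC, hb⟩ := h.regular
  refine ⟨C, hC, fun x y hxy => ?_⟩
  obtain ⟨x', rfl, rfl⟩ := (LinearPMap.mem_graph_iff _).1 hxy
  exact hb x'

lemma isClosed_pencilRange (h : IsRegularPencil A B l) :
    IsClosed (pencilRange A B l : Set H) := by
  obtain ⟨C, hC, hb⟩ := h.exists_bound
  have hcl : IsClosed (A.graph : Set (H × H)) := h.closed
  have hcomp : CompleteSpace A.graph := hcl.completeSpace_coe
  let f : A.graph →L[ℂ] H := (pencilMap B l) ∘L A.graph.subtypeL
  have hf : AntilipschitzWith (Real.toNNReal (C⁻¹ + (1 + ‖(l : ℂ) • B‖ * C⁻¹))) f := by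
    refine AddMonoidHomClass.antilipschitz_of_bound f ?_
    rintro ⟨⟨x, y⟩, hxy⟩
    rw [Real.coe_toNNReal _ (by positivity)]
    have hfx : f ⟨(x, y), hxy⟩ = y - (l : ℂ) • B x := rfl
    rw [hfx]
    have h1 : ‖x‖ ≤ C⁻¹ * ‖y - (l : ℂ) • B x‖ := by
      rw [inv_mul_eq_div, le_div_iff₀ hC, mul_comm]
      exact hb x y hxy
    have h2 : ‖y‖ ≤ ‖y - (l : ℂ) • B x‖ + ‖(l : ℂ) • B‖ * ‖x‖ := by
      have h3 := norm_add_le (y - (l : ℂ) • B x) (((l : ℂ) • B) x)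
      have h4 : y - (l : ℂ) • B x + ((l : ℂ) • B) x = y := sub_add_cancel _ _
      rw [h4] at h3
      exact h3.trans (by gcongr; exact ContinuousLinearMap.le_opNorm _ _)
    have h5 : ‖(l : ℂ) • B‖ * ‖x‖ ≤ ‖(l : ℂ) • B‖ * (C⁻¹ * ‖y - (l : ℂ) • B x‖) := by gcongr
    have h6 : 0 ≤ C⁻¹ * ‖y - (l : ℂ) • B x‖ := by positivity
    have h7 : 0 ≤ ‖(l : ℂ) • B‖ * (C⁻¹ * ‖y - (l : ℂ) • B x‖) := by positivity
    have h8 := norm_nonneg (y - (l : ℂ) • B x)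
    change max ‖x‖ ‖y‖ ≤ _
    refine max_le ?_ ?_ <;> linarith
  have := hf.isClosed_range f.uniformContinuous
  convert this using 1
  ext z
  constructor
  · rintro ⟨p, hp, rfl⟩
    exact ⟨⟨p, hp⟩, rfl⟩
  · rintro ⟨⟨p, hp⟩, rfl⟩
    exact ⟨p, hp, rfl⟩

/-- The graph of `A*` over the kernel of `A* - l B` meets the graph of `A` only at zero, because
`A - l B` is injective. -/
lemma finiteDimensional_orthogonal (h : IsRegularPencil A B l) :
    FiniteDimensional ℂ (pencilRange A B l)ᗮ := by
  obtain ⟨C, hC, hb⟩ := h.exists_bound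
  obtain ⟨F, hF, hle⟩ := h.finite
  let g : H →ₗ[ℂ] H × H := LinearMap.id.prod ((l : ℂ) • B.toLinearMap)
  have hg : Function.Injective g := fun x y hxy => congrArg Prod.fst hxy
  have : FiniteDimensional ℂ ((pencilRange A B l)ᗮ.map g) := by
    refine finiteDimensional_of_le_sup (G := A.graph) (F := F) ?_ ?_
    · rintro _ ⟨x, hx, rfl⟩
      exact hle ((mem_orthogonal_pencilRange h.dense h.selfAdjoint).1 hx)
    · rw [Submodule.disjoint_def]
      rintro _ ⟨x, hx, rfl⟩ hxA
      have := hb x ((l : ℂ) • B x) hxA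
      rw [sub_self, norm_zero] at this
      have hx0 : x = 0 := by
        rw [← norm_le_zero_iff]
        exact nonpos_of_mul_nonpos_right this hC
      rw [hx0, map_zero]
  exact Module.Finite.of_injective (g.submoduleMap (pencilRange A B l)ᗮ)
    ((Submodule.equivMapOfInjective g hg _).injective)

lemma isClosed_of_pencilRange_le (h : IsRegularPencil A B l) {M : Submodule ℂ H}
    (hM : pencilRange A B l ≤ M) : IsClosed (M : Set H) := by
  have := h.finiteDimensional_orthogonal
  have : CompleteSpace (pencilRange A B l) := h.isClosed_pencilRange.completeSpace_coe
  refine isClosed_of_le_of_le_sup (F := (pencilRange A B l)ᗮ) h.isClosed_pencilRange hM ?_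
  rw [Submodule.sup_orthogonal_of_hasOrthogonalProjection]
  exact le_top

/-- The range of `A - l B` is closed and of finite codimension, and the range of `|B|^{1/2}` is
dense; so they span `H`. -/
lemma pencilRange_sup_range (h : IsRegularPencil A B l) :
    pencilRange A B l ⊔ LinearMap.range (toKAdjoint B) = ⊤ := by
  have hc := h.isClosed_of_pencilRange_le
    (le_sup_left (a := pencilRange A B l) (b := LinearMap.range (toKAdjoint B)))
  refine SetLike.coe_injective ?_
  rw [← hc.closure_eq, Submodule.top_coe, ← dense_iff_closure_eq]
  refine (denseRange_rootAbs h.selfAdjoint h.injective).mono ?_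
  rintro _ ⟨w, rfl⟩
  obtain ⟨k, -, hk⟩ := range_toKAdjoint h.selfAdjoint h.injective w
  exact Submodule.mem_sup_right ⟨k, hk⟩

/-- Every vector of the domain of an extension `A'` of `A` differs by a vector of `D(A)` from one
that `A'` maps into the range of `|B|^{1/2}`. -/
lemma exists_decomposition (h : IsRegularPencil A B l) {A' : H →ₗ.[ℂ] H} (hA' : A ≤ A')
    {x y : H} (hxy : (x, y) ∈ A'.graph) :
    ∃ x₀ y₀, (x₀, y₀) ∈ A.graph ∧ ∃ k, (x - x₀, toKAdjoint B k) ∈ A'.graph ∧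
      toKAdjoint B k = y - y₀ := by
  have hy : y ∈ pencilRange A B l ⊔ LinearMap.range (toKAdjoint B) := by
    rw [h.pencilRange_sup_range]; trivial
  obtain ⟨u, hu, _, ⟨k, rfl⟩, huk⟩ := Submodule.mem_sup.1 hy
  obtain ⟨x₀, y₀, hxy₀, rfl⟩ := mem_pencilRange.1 hu
  -- As `B x₀` is in the range of `|B|^{1/2}`, so is `y - y₀ = k' - l B x₀`.
  have hk : toKAdjoint B (k - (l : ℂ) • toK B x₀) = y - y₀ := by
    rw [map_sub, map_smul, toKAdjoint_toK h.selfAdjoint, ← huk]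
    abel
  refine ⟨x₀, y₀, hxy₀, k - (l : ℂ) • toK B x₀, ?_, hk⟩
  rw [hk]
  exact A'.graph.sub_mem hxy (LinearPMap.le_graph_of_le hA' hxy₀)

/-- Every operator between `A` and `A*` is closed, as it is a finite-dimensional
extension of `A`. -/
lemma isClosed_of_between (h : IsRegularPencil A B l) {A' : H →ₗ.[ℂ] H} (h1 : A ≤ A')
    (h2 : A' ≤ A†) : A'.IsClosed := by
  obtain ⟨F, hF, hle⟩ := h.finite
  exact isClosed_of_le_of_le_sup h.closed (LinearPMap.le_graph_of_le h1)
    ((LinearPMap.le_graph_of_le h2).trans hle)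

lemma le_adjoint_of_between (h : IsRegularPencil A B l) {A' : H →ₗ.[ℂ] H} (h1 : A ≤ A')
    (h2 : A' ≤ A†) : A ≤ A'† := by
  have := adjoint_anti (h.dense.mono h1.1) h2
  rwa [adjoint_adjoint h.dense h.closed (h.dense.mono h.symm.1)] at this

/-- The range of `A'* - l B` is the orthogonal complement of the kernel of `A' - l B`. -/
lemma mem_pencilRange_adjoint (h : IsRegularPencil A B l) {A' : H →ₗ.[ℂ] H} (h1 : A ≤ A')
    (h2 : A' ≤ A†) {f : H}
    (hf : ∀ z, (z, (l : ℂ) • B z) ∈ A'.graph → inner ℂ z f = 0) : f ∈ pencilRange A'† B l := by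
  have hA := h.le_adjoint_of_between h1 h2
  have hd := h.dense.mono h1.1
  have hd' := h.dense.mono hA.1
  have hc := h.isClosed_of_pencilRange_le (pencilRange_mono B l hA)
  have : CompleteSpace (pencilRange A'† B l) := hc.completeSpace_coe
  rw [← Submodule.orthogonal_orthogonal (pencilRange A'† B l)]
  intro z hz
  rw [mem_orthogonal_pencilRange hd' h.selfAdjoint,
    adjoint_adjoint hd (h.isClosed_of_between h1 h2) hd'] at hz
  exact hf z hz

/-- The inclusion of the reduction of `A'*` in the adjoint of the reduction of `A'`, which needs
only the duality of `toK` and `toKAdjoint`. -/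
lemma mem_kreinAdjointGraph_of_adjoint (h : IsRegularPencil A B l) {A' : H →ₗ.[ℂ] H}
    (hd : Dense (A'.domain : Set H)) {x : H} {w : K B} (hx : (x, toKAdjoint B w) ∈ A'†.graph) :
    (toK B x, w) ∈ kreinAdjointGraph B (reduction B A') := by
  rw [mem_kreinAdjointGraph]
  intro k v hkv
  obtain ⟨z, rfl, hz⟩ := (mem_graph_reduction h.selfAdjoint h.injective A' _ _).1 hkv
  rw [kreinForm_toK_right, kreinForm_toK_left]
  exact (mem_graph_adjoint hd _).1 hx _ _ hz

/-- A vector of `K` that is orthogonal to `{v : |B|^{1/2} J T v ∈ Nᗮ}`, for a finite-dimensional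
subspace `N` of `H`, lies in `N`. -/
lemma mem_map_toK_of_kreinForm_eq_zero (hB : IsSelfAdjoint B) (h0 : Function.Injective B)
    {N : Submodule ℂ H} [FiniteDimensional ℂ N] {u : K B}
    (hu : ∀ v, toKAdjoint B v ∈ Nᗮ → kreinForm B v u = 0) : ∃ x ∈ N, toK B x = u := by
  let N' : Submodule ℂ H := N.map ((sgn B).toLinearMap ∘ₗ (rootAbs B).toLinearMap)
  have key : sgn B (T B u) ∈ N'ᗮᗮ := by
    intro t ht
    obtain ⟨v, rfl⟩ := T_surjective hB h0 t
    rw [← inner_sgn_left]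
    refine hu v fun x hx => ?_
    rw [toKAdjoint_apply, ← inner_rootAbs_left, ← inner_sgn_left]
    exact ht _ ⟨x, hx, rfl⟩
  rw [Submodule.orthogonal_orthogonal] at key
  obtain ⟨x, hx, hxu⟩ := key
  refine ⟨x, hx, T_injective B ?_⟩
  have := congrArg (sgn B) hxu
  change sgn B (sgn B (rootAbs B x)) = _ at this
  rw [sgn_sgn hB h0, sgn_sgn hB h0] at this
  rw [T_toK, this]

/-- The adjoint of the reduction of `A'` is the reduction of `A'*`, at the level of graphs. -/
lemma kreinAdjointGraph_reduction (h : IsRegularPencil A B l) {A' : H →ₗ.[ℂ] H} (h1 : A ≤ A')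
    (h2 : A' ≤ A†) :
    kreinAdjointGraph B (reduction B A') = (reduction B A'†).graph := by
  have hB := h.selfAdjoint
  have h0 := h.injective
  have hd := h.dense.mono h1.1
  refine le_antisymm ?_ ?_
  · rintro ⟨u, w⟩ huw
    rw [mem_kreinAdjointGraph] at huw
    have hBs : ∀ x y : H, inner ℂ (B x) y = inner ℂ x (B y) := fun x y => hB.isSymmetric x y
    have huw' : ∀ z v, (z, toKAdjoint B v) ∈ A'.graph →
        kreinForm B v u = inner ℂ z (toKAdjoint B w) := by
      intro z v hz
      rw [← kreinForm_toK_left]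
      exact huw _ _ ((toK_mem_graph_reduction hB h0 A' z v).2 hz)
    have hadd : ∀ (v : K B) (z : H), kreinForm B (v + (l : ℂ) • toK B z) u =
        kreinForm B v u + l * inner ℂ z (toKAdjoint B u) := by
      intro v z
      rw [← kreinForm_toK_left]
      simp only [kreinForm, map_add, map_smul, inner_add_left, inner_smul_left,
        Complex.conj_ofReal]
    -- If `(u, w)` is in the graph of the adjoint, then `w - l u` corresponds to a vector in the
    -- range of `A'* - l B`.
    obtain ⟨x₀, y₀, hxy₀, hf⟩ := mem_pencilRange.1
      (h.mem_pencilRange_adjoint h1 h2 (f := toKAdjoint B w - (l : ℂ) • toKAdjoint B u) (by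
        intro z hz
        have := huw' z (0 + (l : ℂ) • toK B z) (by
          rw [zero_add, map_smul, toKAdjoint_toK hB]; exact hz)
        rw [hadd] at this
        have h00 : kreinForm B 0 u = 0 := by simp [kreinForm]
        rw [inner_sub_right, inner_smul_right, ← this, h00]
        ring))
    -- `u` and `x₀` have the same products with the vectors that correspond to the range of
    -- `A' - l B`, so they differ by a vector in the kernel of `A'* - l B`.
    have hle : (pencilRange A' B l)ᗮ ≤ (pencilRange A B l)ᗮ :=
      Submodule.orthogonal_le (pencilRange_mono B l h1)
    have := h.finiteDimensional_orthogonal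
    have : FiniteDimensional ℂ (pencilRange A' B l)ᗮ := Submodule.finiteDimensional_of_le hle
    have hcl := h.isClosed_of_pencilRange_le (pencilRange_mono B l h1)
    have : CompleteSpace (pencilRange A' B l) := hcl.completeSpace_coe
    obtain ⟨n, hn, hnu⟩ := mem_map_toK_of_kreinForm_eq_zero hB h0
        (N := (pencilRange A' B l)ᗮ) (u := u - toK B x₀) (by
      intro v hv
      rw [Submodule.orthogonal_orthogonal] at hv
      obtain ⟨z, y, hzy, hyv⟩ := mem_pencilRange.1 hv
      have e1 := huw' z (v + (l : ℂ) • toK B z) (by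
        rw [map_add, map_smul, toKAdjoint_toK hB, ← hyv, sub_add_cancel]; exact hzy)
      rw [hadd] at e1
      have e2 := (mem_graph_adjoint hd _).1 hxy₀ z y hzy
      have e3 : kreinForm B v (u - toK B x₀) =
          kreinForm B v u - inner ℂ (toKAdjoint B v) x₀ := by
        rw [← kreinForm_toK_right]
        simp only [kreinForm, map_sub, inner_sub_right]
      have e4 := congrArg (fun t => inner ℂ z t) hf
      simp only [inner_sub_right, inner_smul_right] at e4 e2
      rw [e3, ← hyv, inner_sub_left, inner_smul_left, Complex.conj_ofReal, hBs, e2]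
      linear_combination e1 - e4)
    have hu : toK B (x₀ + n) = u := by rw [map_add, hnu]; abel
    rw [mem_orthogonal_pencilRange hd hB] at hn
    rw [← hu, toK_mem_graph_reduction hB h0]
    have := A'†.graph.add_mem hxy₀ hn
    have hw : toKAdjoint B w = y₀ + (l : ℂ) • B n := by
      have e : (l : ℂ) • toKAdjoint B u = (l : ℂ) • B x₀ + (l : ℂ) • B n := by
        rw [← hu, toKAdjoint_toK hB, map_add, smul_add]
      rw [e] at hf
      rw [sub_eq_iff_eq_add.1 hf.symm]
      abel
    rw [hw]
    exact this
  · rintro ⟨u, w⟩ huw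
    obtain ⟨x, rfl, hx⟩ := (mem_graph_reduction hB h0 _ _ _).1 huw
    exact h.mem_kreinAdjointGraph_of_adjoint hd hx

/-- If `h ∈ K` is orthogonal to the domain of the reduction, then `(0, h)` is in the graph of the
adjoint relation, which is the graph of an operator. -/
lemma dense_domain_reduction (h : IsRegularPencil A B l) :
    Dense ((reduction B A).domain : Set (K B)) := by
  have hB := h.selfAdjoint
  have h0 := h.injective
  rw [Submodule.dense_iff_topologicalClosure_eq_top, Submodule.topologicalClosure_eq_top_iff,
    Submodule.eq_bot_iff]
  intro k hk
  obtain ⟨m, hm⟩ := T_surjective hB h0 (sgn B (T B k))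
  have hm0 : ((0, m) : K B × K B) ∈ kreinAdjointGraph B (reduction B A) := by
    intro x
    have := hk x x.2
    simp only [kreinForm, map_zero, inner_zero_right]
    rw [inner_sgn_left, hm, sgn_sgn hB h0]
    exact this.symm
  rw [h.kreinAdjointGraph_reduction le_rfl h.symm] at hm0
  have hm1 := LinearPMap.graph_fst_eq_zero_snd _ hm0 rfl
  refine T_injective B ?_
  rw [← sgn_sgn hB h0 (T B k), ← hm, hm1]
  simp

/-- The adjoint in the Krein space of the reduction of `A'` is the reduction of `A'*`. -/
lemma kreinAdjoint_reduction (h : IsRegularPencil A B l) {A' : H →ₗ.[ℂ] H} (h1 : A ≤ A')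
    (h2 : A' ≤ A†) : kreinAdjoint B (reduction B A') = reduction B A'† := by
  refine LinearPMap.eq_of_eq_graph ?_
  rw [graph_kreinAdjoint h.selfAdjoint h.injective
    (h.dense_domain_reduction.mono (reduction_mono h.selfAdjoint h.injective h1).1),
    h.kreinAdjointGraph_reduction h1 h2]

end IsRegularPencil

end Pencil

/-! ### The correspondence of extensions -/

section Correspondence

variable {H : Type*} [NormedAddCommGroup H] [InnerProductSpace ℂ H] [CompleteSpace H]

namespace IsRegularPencil

variable {A : H →ₗ.[ℂ] H} {B : H →L[ℂ] H} {l : ℝ}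

lemma le_of_reduction_eq (h : IsRegularPencil A B l) {A₁ A₂ : H →ₗ.[ℂ] H} (h1 : A ≤ A₁)
    (h2 : A ≤ A₂) (heq : reduction B A₁ = reduction B A₂) : A₁ ≤ A₂ := by
  refine LinearPMap.le_of_le_graph ?_
  rintro ⟨x, y⟩ hxy
  obtain ⟨x₀, y₀, hxy₀, k, hk, hky⟩ := h.exists_decomposition h1 hxy
  rw [← toK_mem_graph_reduction h.selfAdjoint h.injective, heq,
    toK_mem_graph_reduction h.selfAdjoint h.injective, hky] at hk
  simpa using A₂.graph.add_mem hk (LinearPMap.le_graph_of_le h2 hxy₀)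

lemma eq_of_reduction_eq (h : IsRegularPencil A B l) {A₁ A₂ : H →ₗ.[ℂ] H} (h1 : A ≤ A₁)
    (h2 : A ≤ A₂) (heq : reduction B A₁ = reduction B A₂) : A₁ = A₂ :=
  le_antisymm (h.le_of_reduction_eq h1 h2 heq) (h.le_of_reduction_eq h2 h1 heq.symm)

/-- The preimage of `S'` is spanned by `A` and by the restriction of `A*` to the vectors in the
domain of `S'`. -/
lemma exists_reduction_eq (h : IsRegularPencil A B l) {S' : K B →ₗ.[ℂ] K B}
    (h1 : reduction B A ≤ S') (h2 : S' ≤ reduction B A†) :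
    ∃ A', A ≤ A' ∧ A' ≤ A† ∧ reduction B A' = S' := by
  have hB := h.selfAdjoint
  have h0 := h.injective
  let G : Submodule ℂ (H × H) :=
    (S'.graph.comap ((toK B).prodMap LinearMap.id)).map (LinearMap.id.prodMap (toKAdjoint B))
  have hG : A.graph ⊔ G ≤ A†.graph := by
    refine sup_le (LinearPMap.le_graph_of_le h.symm) ?_
    rintro _ ⟨⟨x, k⟩, hxk, rfl⟩
    exact (toK_mem_graph_reduction hB h0 _ _ _).1 (LinearPMap.le_graph_of_le h2 hxk)
  have hgr : (A.graph ⊔ G).toLinearPMap.graph = A.graph ⊔ G :=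
    Submodule.toLinearPMap_graph_eq _ fun x hx hx' =>
      LinearPMap.graph_fst_eq_zero_snd _ (hG hx) hx'
  refine ⟨(A.graph ⊔ G).toLinearPMap, ?_, ?_, ?_⟩
  · refine LinearPMap.le_of_le_graph ?_
    rw [hgr]
    exact le_sup_left
  · refine LinearPMap.le_of_le_graph ?_
    rw [hgr]
    exact hG
  · refine LinearPMap.eq_of_eq_graph (le_antisymm ?_ ?_)
    · rintro ⟨k, m⟩ hkm
      obtain ⟨x, rfl, hx⟩ := (mem_graph_reduction hB h0 _ _ _).1 hkm
      rw [hgr] at hx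
      obtain ⟨⟨x₀, y₀⟩, hxy₀, _, ⟨⟨x₁, k₁⟩, hxk₁, rfl⟩, hsum⟩ := Submodule.mem_sup.1 hx
      have e1 : x₀ + x₁ = x := congrArg Prod.fst hsum
      have e2 : y₀ + toKAdjoint B k₁ = toKAdjoint B m := congrArg Prod.snd hsum
      have hx₀ : (toK B x₀, m - k₁) ∈ S'.graph := by
        refine LinearPMap.le_graph_of_le h1 ((toK_mem_graph_reduction hB h0 _ _ _).2 ?_)
        rw [map_sub, ← e2, add_sub_cancel_right]
        exact hxy₀
      have hx₁ : (toK B x₁, k₁) ∈ S'.graph := hxk₁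
      simpa [← e1] using S'.graph.add_mem hx₀ hx₁
    · rintro ⟨k, m⟩ hkm
      obtain ⟨x, rfl, hx⟩ := (mem_graph_reduction hB h0 _ _ _).1 (LinearPMap.le_graph_of_le h2 hkm)
      rw [toK_mem_graph_reduction hB h0, hgr]
      exact Submodule.mem_sup_right ⟨(x, m), hkm, rfl⟩

/-- Closed extensions are themselves adjoints, and so are their reductions. -/
lemma isClosed_reduction (h : IsRegularPencil A B l) {A' : H →ₗ.[ℂ] H} (h1 : A ≤ A')
    (h2 : A' ≤ A†) : (reduction B A').IsClosed := by
  have hB := h.selfAdjoint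
  have h0 := h.injective
  have hA := h.le_adjoint_of_between h1 h2
  have hA2 := adjoint_anti h.dense h1
  have := h.kreinAdjoint_reduction hA hA2
  rw [adjoint_adjoint (h.dense.mono h1.1) (h.isClosed_of_between h1 h2)
    (h.dense.mono hA.1)] at this
  rw [← this]
  exact isClosed_kreinAdjoint hB h0 (h.dense_domain_reduction.mono (reduction_mono hB h0 hA).1)

lemma bijOn_closedExtensions (h : IsRegularPencil A B l) :
    Set.BijOn (reduction B) (closedExtensions A)
      (kreinClosedExtensions B (reduction B A)) := by
  have hB := h.selfAdjoint
  have h0 := h.injective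
  have hS := h.kreinAdjoint_reduction le_rfl h.symm
  refine ⟨?_, ?_, ?_⟩
  · rintro A' ⟨h1, h2, -⟩
    refine ⟨reduction_mono hB h0 h1, ?_, h.isClosed_reduction h1 h2⟩
    rw [hS]
    exact reduction_mono hB h0 h2
  · rintro A₁ ⟨h1, -, -⟩ A₂ ⟨h2, -, -⟩ heq
    exact h.eq_of_reduction_eq h1 h2 heq
  · rintro S' ⟨h1, h2, -⟩
    rw [hS] at h2
    obtain ⟨A', hA1, hA2, rfl⟩ := h.exists_reduction_eq h1 h2
    exact ⟨A', ⟨hA1, hA2, h.isClosed_of_between hA1 hA2⟩, rfl⟩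

lemma reduction_mem_kreinSelfAdjointExtensions (h : IsRegularPencil A B l) {A' : H →ₗ.[ℂ] H}
    (h1 : A ≤ A') (hA' : IsSelfAdjoint A') :
    reduction B A' ∈ kreinSelfAdjointExtensions B (reduction B A) := by
  have hm := reduction_mono h.selfAdjoint h.injective h1
  have heq : A'† = A' := hA'
  have h2 := adjoint_anti h.dense h1
  rw [heq] at h2
  refine ⟨hm, h.dense_domain_reduction.mono hm.1, ?_⟩
  rw [h.kreinAdjoint_reduction h1 h2, heq]

lemma bijOn_selfAdjointExtensions (h : IsRegularPencil A B l) :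
    Set.BijOn (reduction B) (selfAdjointExtensions A)
      (kreinSelfAdjointExtensions B (reduction B A)) := by
  have hB := h.selfAdjoint
  have h0 := h.injective
  refine ⟨?_, ?_, ?_⟩
  · rintro A' ⟨h1, hA'⟩
    exact h.reduction_mem_kreinSelfAdjointExtensions h1 hA'
  · rintro A₁ ⟨h1, -⟩ A₂ ⟨h2, -⟩ heq
    exact h.eq_of_reduction_eq h1 h2 heq
  · rintro S' ⟨h1, hd, hsa⟩
    have h2 := kreinAdjoint_anti hB h0 h.dense_domain_reduction h1
    rw [hsa, h.kreinAdjoint_reduction le_rfl h.symm] at h2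
    obtain ⟨A', hA1, hA2, rfl⟩ := h.exists_reduction_eq h1 h2
    rw [h.kreinAdjoint_reduction hA1 hA2] at hsa
    exact ⟨A', ⟨hA1, h.eq_of_reduction_eq (h.le_adjoint_of_between hA1 hA2) hA1 hsa⟩, rfl⟩

end IsRegularPencil

end Correspondence

/-! ### Spaces of boundary values -/

section BoundaryValues

variable {H Ω : Type*} [NormedAddCommGroup H] [InnerProductSpace ℂ H]
  [NormedAddCommGroup Ω] [InnerProductSpace ℂ Ω]

lemma mem_graph_boundaryRestriction (R : H →ₗ.[ℂ] H) (Γ₁ Γ₂ : R.domain →ₗ[ℂ] Ω)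
    (θ : Submodule ℂ (Ω × Ω)) (p : H × H) :
    p ∈ (boundaryRestriction R Γ₁ Γ₂ θ).graph ↔
      ∃ x : R.domain, (x : H) = p.1 ∧ R x = p.2 ∧ (Γ₂ x, Γ₁ x) ∈ θ := by
  rw [LinearPMap.mem_graph_iff]
  constructor
  · rintro ⟨⟨_, ⟨x, hx, rfl⟩, hxd⟩, h1, h2⟩
    exact ⟨x, h1, by rw [← h2]; exact (LinearPMap.domRestrict_apply rfl).symm, hx⟩
  · rintro ⟨x, h1, h2, hx⟩
    refine ⟨⟨x, ⟨x, hx, rfl⟩, x.2⟩, h1, ?_⟩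
    rw [← h2]
    exact LinearPMap.domRestrict_apply rfl

variable [CompleteSpace H] [CompleteSpace Ω]

/-- By Green's formula, the boundary values vanish exactly on the domain of `A`. -/
lemma IsBoundaryValueSpace.eq_zero_iff {A : H →ₗ.[ℂ] H} (hA : Dense (A.domain : Set H))
    (hc : A.IsClosed) {Γ₁ Γ₂ : A†.domain →ₗ[ℂ] Ω}
    (hΓ : IsBoundaryValueSpace (fun x y : H => inner ℂ x y) A† 1 Γ₁ Γ₂) (x : A†.domain) :
    (Γ₁ x = 0 ∧ Γ₂ x = 0) ↔ ((x : H), A† x) ∈ A.graph := by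
  have green := hΓ.green
  simp only [one_apply_eq_self] at green
  constructor
  · rintro ⟨h1, h2⟩
    refine mem_graph_of_inner_adjoint hA hc fun a b hab => ?_
    obtain ⟨y, rfl, rfl⟩ := (LinearPMap.mem_graph_iff _).1 hab
    have := green y x
    rwa [h1, h2, inner_zero_right, inner_zero_right, sub_zero, sub_eq_zero] at this
  · intro hx
    have h0 : ∀ y, inner ℂ (Γ₁ x) (Γ₂ y) = inner ℂ (Γ₂ x) (Γ₁ y) := by
      intro y
      rw [← sub_eq_zero, ← green x y, sub_eq_zero]
      exact (mem_graph_adjoint hA _).1 (A†.mem_graph y) _ _ hx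
    constructor
    · obtain ⟨y, hy⟩ := hΓ.surjective (0, Γ₁ x)
      obtain ⟨e1, e2⟩ := Prod.mk.inj hy
      have := h0 y
      rw [e1, e2, inner_zero_right] at this
      exact inner_self_eq_zero.1 this
    · obtain ⟨y, hy⟩ := hΓ.surjective (Γ₂ x, 0)
      obtain ⟨e1, e2⟩ := Prod.mk.inj hy
      have := h0 y
      rw [e1, e2, inner_zero_right] at this
      exact inner_self_eq_zero.1 this.symm

namespace IsRegularPencil

variable {A : H →ₗ.[ℂ] H} {B : H →L[ℂ] H} {l : ℝ}

lemma finiteDimensional_boundary (h : IsRegularPencil A B l) {Γ₁ Γ₂ : A†.domain →ₗ[ℂ] Ω}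
    (hΓ : IsBoundaryValueSpace (fun x y : H => inner ℂ x y) A† 1 Γ₁ Γ₂) :
    FiniteDimensional ℂ (Ω × Ω) := by
  obtain ⟨F, hF, hle⟩ := h.finite
  let F' : Submodule ℂ (H × H) := A†.graph ⊓ F
  have : FiniteDimensional ℂ F' := Submodule.finiteDimensional_of_le inf_le_right
  let r : F' →ₗ[ℂ] A†.domain := LinearMap.codRestrict A†.domain
    (LinearMap.fst ℂ H H ∘ₗ F'.subtype) fun p => LinearPMap.mem_domain_of_mem_graph p.2.1
  refine Module.Finite.of_surjective ((Γ₁.prod Γ₂) ∘ₗ r) fun ω => ?_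
  obtain ⟨x, hx⟩ := hΓ.surjective ω
  obtain ⟨a, ha, f, hf, haf⟩ := Submodule.mem_sup.1 (hle (A†.mem_graph x))
  have ha' := LinearPMap.le_graph_of_le h.symm ha
  have hf' : f ∈ A†.graph := by
    rw [← eq_sub_iff_add_eq'] at haf
    rw [haf]
    exact A†.graph.sub_mem (A†.mem_graph x) ha'
  obtain ⟨y, hy1, hy2⟩ := (LinearPMap.mem_graph_iff _).1 ha'
  have hy : ((y : H), A† y) ∈ A.graph := by rw [hy1, hy2]; exact ha
  obtain ⟨e1, e2⟩ := (hΓ.eq_zero_iff h.dense h.closed y).2 hy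
  have hxy : x = y + r ⟨f, hf', hf⟩ :=
    Subtype.ext ((congrArg Prod.fst haf).symm.trans (congrArg (· + f.1) hy1.symm))
  rw [← hx]
  refine ⟨⟨f, hf', hf⟩, ?_⟩
  change (Γ₁ _, Γ₂ _) = (Γ₁ x, Γ₂ x)
  rw [hxy, map_add, map_add, e1, e2, zero_add, zero_add]

/-- The boundary maps of `A*`, restricted to the domain of the reduction of `A*`, are bounded for
the graph norm in `K`: they take values in a finite-dimensional space, and their common kernel is
the domain of the reduction of `A`, which is closed. -/
lemma exists_boundaryValueSpace (h : IsRegularPencil A B l) {R : K B →ₗ.[ℂ] K B}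
    (hR : R = reduction B A†) {Γ₁ Γ₂ : A†.domain →ₗ[ℂ] Ω}
    (hΓ : IsBoundaryValueSpace (fun x y : H => inner ℂ x y) A† 1 Γ₁ Γ₂) :
    ∃ Δ₁ Δ₂ : R.domain →ₗ[ℂ] Ω,
      (∀ (x : A†.domain) (hx : toK B x ∈ R.domain),
        Δ₁ ⟨toK B x, hx⟩ = Γ₁ x ∧ Δ₂ ⟨toK B x, hx⟩ = Γ₂ x) ∧
      IsBoundaryValueSpace (kreinForm B) R 1 Δ₁ Δ₂ ∧
      ∀ θ : Submodule ℂ (Ω × Ω),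
        reduction B (boundaryRestriction A† Γ₁ Γ₂ θ) = boundaryRestriction R Δ₁ Δ₂ θ := by
  have hB := h.selfAdjoint
  have h0 := h.injective
  have hmem : ∀ k : R.domain, ∃ x : A†.domain, toK B x = k ∧ A† x = toKAdjoint B (R k) := by
    intro k
    obtain ⟨x, hx, hxk⟩ :=
      (mem_graph_reduction hB h0 _ _ _).1 (LinearPMap.le_graph_of_le hR.le (R.mem_graph k))
    obtain ⟨x', rfl, hx'⟩ := (LinearPMap.mem_graph_iff _).1 hxk
    exact ⟨x', hx, hx'⟩
  choose r hr hRr using hmem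
  have hr_eq : ∀ (k : R.domain) (x : A†.domain), toK B x = k → r k = x := fun k x hx =>
    Subtype.ext (toK_injective hB h0 ((hr k).trans hx.symm))
  let r' : R.domain →ₗ[ℂ] A†.domain :=
    { toFun := r
      map_add' := fun k m => hr_eq _ _ (by simp [hr])
      map_smul' := fun c k => hr_eq _ _ (by simp [hr]) }
  have hr' : ∀ k, r' k = r k := fun _ => rfl
  -- The restriction of the boundary maps is still onto, as they vanish on the domain of `A`.
  have hsurj : Function.Surjective fun k : R.domain => ((Γ₁ ∘ₗ r') k, (Γ₂ ∘ₗ r') k) := by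
    intro ω
    obtain ⟨x, hx⟩ := hΓ.surjective ω
    obtain ⟨x₀, y₀, hxy₀, k, hk, -⟩ := h.exists_decomposition h.symm (A†.mem_graph x)
    have hmk := (toK_mem_graph_reduction hB h0 _ _ _).2 hk
    rw [← hR] at hmk
    obtain ⟨m, hm, -⟩ := (LinearPMap.mem_graph_iff _).1 hmk
    obtain ⟨z, hz1, hz2⟩ := (LinearPMap.mem_graph_iff _).1 (LinearPMap.le_graph_of_le h.symm hxy₀)
    have hz : ((z : H), A† z) ∈ A.graph := by rw [hz1, hz2]; exact hxy₀
    obtain ⟨e1, e2⟩ := (hΓ.eq_zero_iff h.dense h.closed z).2 hz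
    have hrm : r m = x - z := hr_eq _ _ (by
      rw [hm]
      change toK B ((x : H) - z) = toK B (x - x₀)
      rw [hz1])
    refine ⟨m, ?_⟩
    simp only [LinearMap.comp_apply, hr', hrm, map_sub, e1, e2, sub_zero]
    exact hx
  refine ⟨Γ₁ ∘ₗ r', Γ₂ ∘ₗ r', ?_, ⟨?_, ?_, ?_, ?_, hsurj⟩, ?_⟩
  · intro x hx
    have := hr_eq ⟨toK B x, hx⟩ x rfl
    simp only [LinearMap.comp_apply, hr', this, and_self]
  · exact mul_one _
  · exact IsSelfAdjoint.one _
  · have hfin := h.finiteDimensional_boundary hΓ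
    let d : R.graph →ₗ[ℂ] R.domain := LinearMap.codRestrict R.domain
      (LinearMap.fst ℂ (K B) (K B) ∘ₗ R.graph.subtype)
      fun p => LinearPMap.mem_domain_of_mem_graph p.2
    let f : R.graph →ₗ[ℂ] Ω × Ω := ((Γ₁ ∘ₗ r').prod (Γ₂ ∘ₗ r')) ∘ₗ d
    have hker : (LinearMap.ker f : Set R.graph) =
        Subtype.val ⁻¹' ((reduction B A).graph : Set (K B × K B)) := by
      ext ⟨p, hp⟩
      obtain ⟨k, rfl⟩ := (LinearPMap.mem_graph_iff' _).1 hp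
      have hfk : f ⟨((k : K B), R k), hp⟩ = (Γ₁ (r k), Γ₂ (r k)) := rfl
      rw [SetLike.mem_coe, LinearMap.mem_ker, hfk, Prod.mk_eq_zero,
        hΓ.eq_zero_iff h.dense h.closed, Set.mem_preimage, SetLike.mem_coe]
      change _ ↔ ((k : K B), R k) ∈ _
      rw [← hr k, toK_mem_graph_reduction hB h0, hRr]
    have hcont : Continuous f := by
      refine continuous_of_isClosed_ker f ?_
      rw [hker]
      exact IsClosed.preimage continuous_subtype_val (h.isClosed_reduction le_rfl h.symm)
    let fc : R.graph →L[ℂ] Ω × Ω := ⟨f, hcont⟩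
    refine ⟨‖fc‖, fun k => ?_⟩
    have hb : ‖(Γ₁ (r k), Γ₂ (r k))‖ ≤ ‖fc‖ * √(‖(k : K B)‖ ^ 2 + ‖R k‖ ^ 2) := by
      refine (fc.le_opNorm ⟨((k : K B), R k), R.mem_graph k⟩).trans ?_
      gcongr
      change max ‖(k : K B)‖ ‖R k‖ ≤ _
      refine max_le ?_ ?_ <;> refine Real.le_sqrt_of_sq_le ?_ <;>
        nlinarith [sq_nonneg ‖(k : K B)‖, sq_nonneg ‖R k‖]
    exact ⟨(norm_fst_le (Γ₁ (r k), Γ₂ (r k))).trans hb, (norm_snd_le (Γ₁ (r k), Γ₂ (r k))).trans hb⟩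
  · intro k m
    have := hΓ.green (r k) (r m)
    rw [hRr, hRr, ← kreinForm_toK_left, ← kreinForm_toK_right, hr, hr] at this
    exact this
  · intro θ
    refine LinearPMap.eq_of_eq_graph (Submodule.ext ?_)
    rintro ⟨k, m⟩
    rw [mem_graph_reduction hB h0, mem_graph_boundaryRestriction]
    constructor
    · rintro ⟨x, rfl, hx⟩
      obtain ⟨x', rfl, hx', hθ⟩ := (mem_graph_boundaryRestriction _ _ _ _ _).1 hx
      have hmk : (toK B x', m) ∈ R.graph := by
        rw [hR, toK_mem_graph_reduction hB h0]
        exact (LinearPMap.mem_graph_iff _).2 ⟨x', rfl, hx'⟩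
      obtain ⟨p, hp, hpm⟩ := (LinearPMap.mem_graph_iff _).1 hmk
      refine ⟨p, hp, hpm, ?_⟩
      simpa only [LinearMap.comp_apply, hr', hr_eq p x' hp.symm] using hθ
    · rintro ⟨p, rfl, rfl, hθ⟩
      exact ⟨r p, hr p, (mem_graph_boundaryRestriction _ _ _ _ _).2 ⟨r p, rfl, hRr p, hθ⟩⟩

end IsRegularPencil

end BoundaryValues

end PencilReduction

theorem theorem2p12 {H : Type*} [NormedAddCommGroup H] [InnerProductSpace ℂ H] [CompleteSpace H]
    (A : H →ₗ.[ℂ] H) (hA_dense : Dense (A.domain : Set H)) (hA_symm : A ≤ A†)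
    (hA_closed : A.IsClosed)
    (n : ℕ) (hA_def : HasDeficiencyIndices A n n)
    (B : H →L[ℂ] H) (hB : IsSelfAdjoint B)
    (hB0 : (0 : ℂ) ∈ continuousSpectrum B)
    (hreg : ∃ l : ℝ, (l : ℂ) ∈ regularPoints A B) :
    let S := reduction B A
    -- `S` is a closed symmetric operator in the Krein space, with `S* = T⁻¹ J |B|^{-1/2} A*`
    (Dense (S.domain : Set (K B)) ∧ S.IsClosed ∧
      S ≤ kreinAdjoint B S ∧
      kreinAdjoint B S = reduction B A†) ∧
    -- the correspondence between closed extensions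
    Set.BijOn (reduction B) (closedExtensions A)
      (kreinClosedExtensions B S) ∧
    -- the correspondence between selfadjoint extensions
    Set.BijOn (reduction B) (selfAdjointExtensions A)
      (kreinSelfAdjointExtensions B S) ∧
    -- the extension of `S` given by a selfadjoint extension of `A`
    (∀ A' : H →ₗ.[ℂ] H, A ≤ A' → IsSelfAdjoint A' →
      ∃ S' : K B →ₗ.[ℂ] K B,
        (∀ k : K B, k ∈ S'.domain ↔
          ∃ x : A'.domain, (∃ w : H, rootAbs B w = A' x) ∧
            toK B x = k) ∧
        (∀ (x : A'.domain) (w : H) (hx : toK B x ∈ S'.domain),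
          rootAbs B w = A' x →
            T B (S' ⟨toK B x, hx⟩) = sgn B w) ∧
        S' = reduction B A' ∧
        S ≤ S' ∧ IsKreinSelfAdjoint B S') ∧
    -- spaces of boundary values for `A*` restrict to spaces of boundary values for `S*`
    (∀ {Ω : Type*} [NormedAddCommGroup Ω] [InnerProductSpace ℂ Ω] [CompleteSpace Ω]
      (Γ₁ Γ₂ : A†.domain →ₗ[ℂ] Ω),
      IsBoundaryValueSpace (fun x y : H => inner ℂ x y) A† 1 Γ₁ Γ₂ →
      ∃ Δ₁ Δ₂ : (kreinAdjoint B S).domain →ₗ[ℂ] Ω,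
        (∀ (x : A†.domain)
          (hx : toK B x ∈ (kreinAdjoint B S).domain),
          Δ₁ ⟨toK B x, hx⟩ = Γ₁ x ∧ Δ₂ ⟨toK B x, hx⟩ = Γ₂ x) ∧
        IsBoundaryValueSpace (kreinForm B)
          (kreinAdjoint B S) 1 Δ₁ Δ₂ ∧
        ∀ θ : Submodule ℂ (Ω × Ω),
          reduction B (boundaryRestriction A† Γ₁ Γ₂ θ) =
            boundaryRestriction (kreinAdjoint B S) Δ₁ Δ₂ θ) := by

  obtain ⟨l, hl⟩ := hreg
  have h0 : Function.Injective B := by simpa using hB0.2.1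
  have h : IsRegularPencil A B l :=
    ⟨hA_dense, hA_symm, hA_closed, exists_graph_adjoint_le_graph_sup hA_dense hA_symm hA_def, hB,
      h0, hl⟩
  have hS := h.kreinAdjoint_reduction le_rfl hA_symm
  refine ⟨⟨h.dense_domain_reduction, h.isClosed_reduction le_rfl hA_symm, ?_, hS⟩,
    h.bijOn_closedExtensions, h.bijOn_selfAdjointExtensions, ?_, ?_⟩
  · rw [hS]
    exact reduction_mono hB h0 hA_symm
  · intro A' h1 hA'
    have hext := h.reduction_mem_kreinSelfAdjointExtensions h1 hA'
    refine ⟨reduction B A', ?_, ?_, rfl, hext.1, hext.2⟩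
    · intro k
      rw [LinearPMap.mem_domain_iff, reduction_graph B hB h0]
      constructor
      · rintro ⟨m, x, w, h1, h2, -⟩
        exact ⟨x, ⟨w, h1⟩, h2.symm⟩
      · rintro ⟨x, ⟨w, h1⟩, h2⟩
        obtain ⟨m, hm, -⟩ := range_toKAdjoint hB h0 w
        exact ⟨m, x, w, h1, h2.symm, hm⟩
    · intro x w hx hw
      have := (reduction B A').mem_graph ⟨toK B x, hx⟩
      rw [reduction_graph B hB h0] at this
      obtain ⟨y, v, h1, h2, h3⟩ := this
      have hxy : x = y := Subtype.ext (toK_injective hB h0 h2)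
      rw [h3, rootAbs_injective B hB h0 (h1.trans ((congrArg A' hxy.symm).trans hw.symm))]
  · intro Ω _ _ _ Γ₁ Γ₂ hΓ
    exact h.exists_boundaryValueSpace hS hΓ
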